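/- Let $\mathbb K=\mathbb R$ or $\mathbb C$ (smooth functions over $\mathbb C$ are holomorphic). **(A) RKdV.** Consider the Lax pair of the reciprocal KdV equation for $M=M(y,T)$ and $\Phi=\Phi(y,T,\lambda)$, $$\Phi_{yy}=-\frac{M_y}{M}\Phi_y+\Big[\frac1M-\frac{\lambda}{M^2}\Big]\Phi,\qquad \Phi_T=\left(M^2M_{yy}+MM_y^2-M^2+4\lambda M\right)\Phi_y-MM_y\Phi,$$ where $\lambda$ is an independent variable, so that $M_\lambda=0$ (hence $M_{y\lambda}=M_{T\lambda}=M_{\lambda\lambda}=0$) belongs to the system. Let $\Omega$ be a nonempty connected open set of points $(y,T,\lambda,M,\Phi)\in\mathbb K^5$ on which $M\ne0$ and whose sections $\{\lambda=\mathrm{const}\}$ are connected (for example a convex set). A smooth vector field $X=\xi_y\partial_y+\xi_T\partial_T+\xi_\lambda\partial_\lambda+\eta_M\partial_M+\eta_\Phi\partial_\Phi$ on $\Omega$, with coefficients depending on $(y,T,\lambda,M,\Phi)$, is a classical Lie point symmetry of the system (that is, its second prolongation annihilates every equation of the system at every second-order jet over $\Omega$ which satisfies all equations of the system) if and only if $$X=C_1\left(y\partial_y-3T\partial_T+2\lambda\partial_\lambda+2M\partial_M\right)+C_2\,\partial_y+C_3\,\partial_T+f(\lambda)\,\Phi\,\partial_\Phi\quad\text{on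 }\Omega$$ with constants $C_1,C_2,C_3\in\mathbb K$ and a smooth function $f$ on the set of values that $\lambda$ takes in $\Omega$. The constants and $f$ are uniquely determined by $X$. The fields $X_1=y\partial_y-3T\partial_T+2\lambda\partial_\lambda+2M\partial_M$, $X_2=\partial_y$, $X_3=\partial_T$ span a three-dimensional Lie algebra, with $[X_1,X_2]=-X_2$, $[X_1,X_3]=3X_3$, $[X_2,X_3]=0$. **(B) RmKdV.** Consider the Lax pair of the reciprocal mKdV equation for $U=U(z,\tau)$ and $\vec\Psi=(\Psi_1,\Psi_2)^{\intercal}(z,\tau,\Lambda)$, $\vec\Psi_z=B\vec\Psi$, $\vec\Psi_\tau=\Lambda C\vec\Psi$, with $$B=\begin{pmatrix}-1&\Lambda/U\\ \Lambda/U&1\end{pmatrix},\qquad C=\begin{pmatrix}4\Lambda U&UU_{zz}+U_z^2-2UU_z-4\Lambda^2\\ UU_{zz}+U_z^2+2UU_z-4\Lambda^2&-4\Lambda U\end{pmatrix},$$ where $\Lambda$ is an independent variable and $U_\Lambda=0$ (hence $U_{z\Lambda}=U_{\tau\Lambda}=U_{\Lambda\Lambda}=0$) belongs to the system. Let $\Omega$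 be a nonempty connected open set of points $(z,\tau,\Lambda,U,\Psi_1,\Psi_2)\in\mathbb K^6$ on which $U\neq0$ and whose sections $\{\Lambda=\mathrm{const}\}$ are connected. A smooth vector field $X$ on $\Omega$ is a classical Lie point symmetry of this system, in the same sense, if and only if $$X=D_1\left(3\tau\partial_\tau-\Lambda\partial_\Lambda-U\partial_U\right)+D_2\,\partial_z+D_3\,\partial_\tau+g(\Lambda)\left(\Psi_1\partial_{\Psi_1}+\Psi_2\partial_{\Psi_2}\right)\quad\text{on }\Omega$$ with constants $D_1,D_2,D_3\in\mathbb K$ and a smooth function $g$ on the set of values that $\Lambda$ takes in $\Omega$; the constants and $g$ are uniquely determined by $X$. -/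

import Mathlib

open scoped ContDiff

noncomputable section

/-! ### Jets and prolongations of point vector fields

`n` independent variables `x` and `m` dependent variables `u`, with values in a field `𝕜`. -/

/-- The space of the independent and dependent variables, with points `(x, u)`. -/
abbrev TotalSpace (𝕜 : Type*) (n m : ℕ) : Type _ := (Fin n → 𝕜) × (Fin m → 𝕜)

/-- First jets `((x, u), u₁)`; the entry `u₁ α i` stands for `∂u^α/∂x^i`. -/
abbrev Jet1 (𝕜 : Type*) (n m : ℕ) : Type _ := TotalSpace 𝕜 n m × (Fin m → Fin n → 𝕜)

/-- Second jets `(((x, u), u₁), u₂)`; the entry `u₂ α i j` stands for `∂²u^α/∂x^i∂x^j`.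
Symmetry in `i, j` is imposed separately, see `Jet2.Symmetric`. -/
abbrev Jet2 (𝕜 : Type*) (n m : ℕ) : Type _ := Jet1 𝕜 n m × (Fin m → Fin n → Fin n → 𝕜)

/-- The mixed second derivatives of a jet agree. -/
def Jet2.Symmetric {𝕜 : Type*} {n m : ℕ} (J : Jet2 𝕜 n m) : Prop :=
  ∀ α i j, J.2 α i j = J.2 α j i

section Prolongation

variable {𝕜 : Type*} [RCLike 𝕜] {n m : ℕ}

/-- The total derivative `D_i F = F_{x^i} + ∑_α u^α_i F_{u^α}` of a function of `(x, u)`. -/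
def totalDeriv0 (F : TotalSpace 𝕜 n m → 𝕜) (i : Fin n) (q : Jet1 𝕜 n m) : 𝕜 :=
  fderiv 𝕜 F q.1 (Pi.single i 1, fun α => q.2 α i)

/-- The total derivative
`D_j G = G_{x^j} + ∑_α u^α_j G_{u^α} + ∑_{α, i} u^α_{ij} G_{u^α_i}` of a function on first jets. -/
def totalDeriv1 (G : Jet1 𝕜 n m → 𝕜) (j : Fin n) (J : Jet2 𝕜 n m) : 𝕜 :=
  fderiv 𝕜 G J.1 ((Pi.single j 1, fun α => J.1.2 α j), fun α i => J.2 α i j)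

/-- First prolongation coefficient `η^α_i = D_i η^α - ∑_j u^α_j D_i ξ^j` of the vector field
`X = ∑_j ξ^j ∂/∂x^j + ∑_α η^α ∂/∂u^α`. -/
def prolong1 (X : TotalSpace 𝕜 n m → TotalSpace 𝕜 n m) (α : Fin m) (i : Fin n)
    (q : Jet1 𝕜 n m) : 𝕜 :=
  totalDeriv0 (fun p => (X p).2 α) i q
    - ∑ j, q.2 α j * totalDeriv0 (fun p => (X p).1 j) i q

/-- Second prolongation coefficient `η^α_{ij} = D_j η^α_i - ∑_k u^α_{ik} D_j ξ^k`. -/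
def prolong2 (X : TotalSpace 𝕜 n m → TotalSpace 𝕜 n m) (α : Fin m) (i j : Fin n)
    (J : Jet2 𝕜 n m) : 𝕜 :=
  totalDeriv1 (prolong1 X α i) j J
    - ∑ k, J.2 α i k * totalDeriv0 (fun p => (X p).1 k) j J.1

/-- The second prolongation `pr⁽²⁾ X`, a vector field on the space of second jets. -/
def prolongation (X : TotalSpace 𝕜 n m → TotalSpace 𝕜 n m) (J : Jet2 𝕜 n m) : Jet2 𝕜 n m :=
  ((X J.1.1, fun α i => prolong1 X α i J.1), fun α i j => prolong2 X α i j J)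

/-- `X` is a (classical) Lie point symmetry on `Ω` of the second order system `Δ_ν = 0`, by Lie's
infinitesimal criterion: `pr⁽²⁾ X (Δ_ν) = 0` for all `ν` at every second jet over `Ω` that
satisfies the whole system. -/
def IsLiePointSymmetry {ι : Type*} (Δ : ι → Jet2 𝕜 n m → 𝕜) (Ω : Set (TotalSpace 𝕜 n m))
    (X : TotalSpace 𝕜 n m → TotalSpace 𝕜 n m) : Prop :=
  ∀ J : Jet2 𝕜 n m, J.Symmetric → J.1.1 ∈ Ω → (∀ ν, Δ ν J = 0) →
    ∀ ν, fderiv 𝕜 (Δ ν) J (prolongation X J) = 0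

/-- Domains in the space of the variables on which vector fields are classified: nonempty, open and
connected, with connected sections `{x^2 = const}` (the third independent variable is
the spectral parameter), and such that the dependent variable `u^field`, which stands in denominators,
does not vanish. A nonempty open convex set on which `u^field ≠ 0` is an example. -/
structure IsLaxDomain (Ω : Set (TotalSpace 𝕜 3 m)) (field : Fin m) : Prop where
  isOpen : IsOpen Ω
  isConnected : IsConnected Ω
  section_isPreconnected : ∀ c : 𝕜, IsPreconnected {p ∈ Ω | p.1 2 = c}
  field_ne_zero : ∀ p ∈ Ω, p.2 field ≠ 0

/-- The set of values of the spectral parameter that occur in `Ω`. -/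
def spectralValues (Ω : Set (TotalSpace 𝕜 3 m)) : Set 𝕜 := (fun p => p.1 2) '' Ω

end Prolongation

/-! ### The Lax pair of RKdV

Independent variables `(y, T, λ) = (x 0, x 1, x 2)`, dependent variables `(M, Φ) = (u 0, u 1)`. -/

section RKdV

variable {𝕜 : Type*} [RCLike 𝕜]

/-- The Lax pair of RKdV for `M = M(y, T)` and `Φ = Φ(y, T, λ)`:
* `Φ_yy = -(M_y / M) Φ_y + (1 / M - λ / M²) Φ`,
* `Φ_T = (M² M_yy + M M_y² - M² + 4 λ M) Φ_y - M M_y Φ`,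
* `M` does not depend on `λ`, i.e. `M_λ = 0` and hence `M_yλ = M_Tλ = M_λλ = 0`. -/
def rkdvLax : Fin 6 → Jet2 𝕜 3 2 → 𝕜 :=
  ![fun J =>
      let lam := J.1.1.1 2
      let M := J.1.1.2 0
      let Φ := J.1.1.2 1
      let M_y := J.1.2 0 0
      let Φ_y := J.1.2 1 0
      let Φ_yy := J.2 1 0 0
      Φ_yy - (-(M_y / M) * Φ_y + (1 / M - lam / M ^ 2) * Φ),
    fun J =>
      let lam := J.1.1.1 2
      let M := J.1.1.2 0
      let Φ := J.1.1.2 1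
      let M_y := J.1.2 0 0
      let Φ_y := J.1.2 1 0
      let Φ_T := J.1.2 1 1
      let M_yy := J.2 0 0 0
      Φ_T - ((M ^ 2 * M_yy + M * M_y ^ 2 - M ^ 2 + 4 * lam * M) * Φ_y - M * M_y * Φ),
    fun J => J.1.2 0 2,
    fun J => J.2 0 0 2,
    fun J => J.2 0 1 2,
    fun J => J.2 0 2 2]

/-- `y ∂_y - 3 T ∂_T + 2 λ ∂_λ + 2 M ∂_M` -/
def rkdvScaling (p : TotalSpace 𝕜 3 2) : TotalSpace 𝕜 3 2 :=
  (![p.1 0, -3 * p.1 1, 2 * p.1 2], ![2 * p.2 0, 0])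

/-- `∂_y` -/
def rkdvShiftY (_p : TotalSpace 𝕜 3 2) : TotalSpace 𝕜 3 2 := (![1, 0, 0], ![0, 0])

/-- `∂_T` -/
def rkdvShiftT (_p : TotalSpace 𝕜 3 2) : TotalSpace 𝕜 3 2 := (![0, 1, 0], ![0, 0])

/-- `Φ ∂_Φ` -/
def rkdvGauge (p : TotalSpace 𝕜 3 2) : TotalSpace 𝕜 3 2 := (![0, 0, 0], ![0, p.2 1])

end RKdV

/-! ### The Lax pair of RmKdV

Independent variables `(z, τ, Λ) = (x 0, x 1, x 2)`, dependent variables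
`(U, Ψ₁, Ψ₂) = (u 0, u 1, u 2)`. -/

section RmKdV

variable {𝕜 : Type*} [RCLike 𝕜]

/-- The Lax pair `Ψ_z = B Ψ`, `Ψ_τ = Λ C Ψ` of RmKdV for `U = U(z, τ)` and
`Ψ = (Ψ₁, Ψ₂)(z, τ, Λ)`, written in components, where `B = [[-1, Λ / U], [Λ / U, 1]]` and
`C = [[4 Λ U, U U_zz + U_z² - 2 U U_z - 4 Λ²], [U U_zz + U_z² + 2 U U_z - 4 Λ², -4 Λ U]]`, together
with `U_Λ = 0` and hence `U_zΛ = U_τΛ = U_ΛΛ = 0`. -/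
def rmkdvLax : Fin 8 → Jet2 𝕜 3 3 → 𝕜 :=
  ![fun J =>
      let Lam := J.1.1.1 2
      let U := J.1.1.2 0
      let Ψ₁ := J.1.1.2 1
      let Ψ₂ := J.1.1.2 2
      let Ψ₁_z := J.1.2 1 0
      Ψ₁_z - (-Ψ₁ + (Lam / U) * Ψ₂),
    fun J =>
      let Lam := J.1.1.1 2
      let U := J.1.1.2 0
      let Ψ₁ := J.1.1.2 1
      let Ψ₂ := J.1.1.2 2
      let Ψ₂_z := J.1.2 2 0
      Ψ₂_z - ((Lam / U) * Ψ₁ + Ψ₂),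
    fun J =>
      let Lam := J.1.1.1 2
      let U := J.1.1.2 0
      let Ψ₁ := J.1.1.2 1
      let Ψ₂ := J.1.1.2 2
      let U_z := J.1.2 0 0
      let Ψ₁_τ := J.1.2 1 1
      let U_zz := J.2 0 0 0
      Ψ₁_τ - Lam * (4 * Lam * U * Ψ₁
        + (U * U_zz + U_z ^ 2 - 2 * U * U_z - 4 * Lam ^ 2) * Ψ₂),
    fun J =>
      let Lam := J.1.1.1 2
      let U := J.1.1.2 0
      let Ψ₁ := J.1.1.2 1
      let Ψ₂ := J.1.1.2 2
      let U_z := J.1.2 0 0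
      let Ψ₂_τ := J.1.2 2 1
      let U_zz := J.2 0 0 0
      Ψ₂_τ - Lam * ((U * U_zz + U_z ^ 2 + 2 * U * U_z - 4 * Lam ^ 2) * Ψ₁
        - 4 * Lam * U * Ψ₂),
    fun J => J.1.2 0 2,
    fun J => J.2 0 0 2,
    fun J => J.2 0 1 2,
    fun J => J.2 0 2 2]

/-- `3 τ ∂_τ - Λ ∂_Λ - U ∂_U` -/
def rmkdvScaling (p : TotalSpace 𝕜 3 3) : TotalSpace 𝕜 3 3 :=
  (![0, 3 * p.1 1, -p.1 2], ![-p.2 0, 0, 0])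

/-- `∂_z` -/
def rmkdvShiftZ (_p : TotalSpace 𝕜 3 3) : TotalSpace 𝕜 3 3 := (![1, 0, 0], ![0, 0, 0])

/-- `∂_τ` -/
def rmkdvShiftTau (_p : TotalSpace 𝕜 3 3) : TotalSpace 𝕜 3 3 := (![0, 1, 0], ![0, 0, 0])

/-- `Ψ₁ ∂_{Ψ₁} + Ψ₂ ∂_{Ψ₂}` -/
def rmkdvGauge (p : TotalSpace 𝕜 3 3) : TotalSpace 𝕜 3 3 := (![0, 0, 0], ![0, p.2 1, p.2 2])

end RmKdV

end

/-! The Lax pair determines Φ_yy and Φ_T (for RmKdV: all z- and τ-derivatives of Ψ) in terms of the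
remaining jet coordinates, which are free apart from the vanishing of M_λ (of U_Λ) and its
derivatives. After this elimination Lie's criterion says that certain polynomials in the free jet
coordinates vanish identically. Their coefficients form an overdetermined linear system of partial
differential equations for the components of X, the determining equations.

Solving that system needs only ring operations, commuting derivations and cancellation of
coordinates, so it is done in an abstract commutative ring with derivations: `rkdv_core` and
`rmkdv_core`. The ring is `smoothRing 𝕜 Ω`, with the partial derivatives `pdiff`. It has zero
divisors, and λ, Φ, Λ, Ψ₁, Ψ₂ may vanish somewhere on Ω, but a coordinate can still be cancelled: x
F = 0 implies x ∂F + F = 0, which settles the points with x = 0. The link between pointwise jets and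
ring elements is `isLiePointSymmetry_rkdvLax_iff` and `isLiePointSymmetry_rmkdvLax_iff`.

The outcome is a differential description of X: one function with zero gradient (the scaling
weight), the remaining components fixed by it up to constants, and a factor H_Φ (respectively H_Ψ₁)
with no derivative transversal to the spectral parameter. Connectedness of Ω makes the first a
constant. Connectedness of the sections makes the second a function of the spectral parameter
(`exists_eq_spectralFun`). The converse is substitution into the determining equations. -/

open scoped ContDiff

noncomputable section

/-! ### Smooth functions on an open set as a ring with commuting derivations -/

section ExtendZero

variable {𝕜 : Type*} [RCLike 𝕜] {E : Type*}

/-- Extension by zero of a function on `Ω`. -/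
def extendZero {Ω : Set E} (F : Ω → 𝕜) : E → 𝕜 := Function.extend Subtype.val F 0

lemma extendZero_apply {Ω : Set E} (F : Ω → 𝕜) {p : E} (hp : p ∈ Ω) :
    extendZero F p = F ⟨p, hp⟩ :=
  Subtype.val_injective.extend_apply F 0 ⟨p, hp⟩

end ExtendZero

section SmoothRing

variable {𝕜 : Type*} [RCLike 𝕜] {E : Type*} [NormedAddCommGroup E] [NormedSpace 𝕜 E]

/-- The algebra of smooth functions on `Ω`. -/
def smoothRing (𝕜 : Type*) [RCLike 𝕜] {E : Type*} [NormedAddCommGroup E] [NormedSpace 𝕜 E]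
    (Ω : Set E) : Subalgebra 𝕜 (Ω → 𝕜) where
  -- Elements are functions on Ω itself, so equality in the ring is equality on Ω. The extension
  -- only makes `fderiv` available; on an open Ω its values outside do not matter.
  carrier := {F | ContDiffOn 𝕜 ∞ (extendZero F) Ω}
  mul_mem' {F G} hF hG := (ContDiffOn.mul hF hG).congr fun p hp => by
    simp [extendZero_apply _ hp]
  add_mem' {F G} hF hG := (ContDiffOn.add hF hG).congr fun p hp => by
    simp [extendZero_apply _ hp]
  algebraMap_mem' c := (contDiffOn_const (c := c)).congr fun p hp => by
    simp [extendZero_apply _ hp]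

/-- The element of `smoothRing 𝕜 Ω` given by a function that is smooth on `Ω`. -/
def toSmooth {Ω : Set E} (F : E → 𝕜) (hF : ContDiffOn 𝕜 ∞ F Ω) : smoothRing 𝕜 Ω :=
  ⟨fun p => F p, hF.congr fun p hp => by simp [extendZero_apply _ hp]⟩

@[simp] lemma toSmooth_apply {Ω : Set E} (F : E → 𝕜) (hF : ContDiffOn 𝕜 ∞ F Ω) (p : Ω) :
    (toSmooth F hF).1 p = F p := rfl

lemma smoothRing_ext {Ω : Set E} {F G : smoothRing 𝕜 Ω} (h : ∀ p : Ω, F.1 p = G.1 p) : F = G :=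
  Subtype.ext (funext h)

omit [NormedSpace 𝕜 E] in
lemma extendZero_eventuallyEq {Ω : Set E} (hΩ : IsOpen Ω) {F : Ω → 𝕜} {G : E → 𝕜} {p : E}
    (hp : p ∈ Ω) (h : ∀ q : Ω, F q = G q) : extendZero F =ᶠ[nhds p] G := by
  filter_upwards [hΩ.mem_nhds hp] with q hq
  rw [extendZero_apply _ hq, h]

lemma ContDiffOn.fderiv_apply_const {F' : Type*} [NormedAddCommGroup F'] [NormedSpace 𝕜 F']
    {Ω : Set E} (hΩ : IsOpen Ω) {F : E → F'} (hF : ContDiffOn 𝕜 ∞ F Ω) (v : E) :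
    ContDiffOn 𝕜 ∞ (fun p => fderiv 𝕜 F p v) Ω :=
  (hF.fderiv_of_isOpen hΩ (by simp)).clm_apply contDiffOn_const

lemma smoothRing_contDiffOn {Ω : Set E} (F : smoothRing 𝕜 Ω) : ContDiffOn 𝕜 ∞ (extendZero F.1) Ω :=
  F.2

lemma smoothRing_differentiableAt {Ω : Set E} (hΩ : IsOpen Ω) (F : smoothRing 𝕜 Ω) (p : Ω) :
    DifferentiableAt 𝕜 (extendZero F.1) p :=
  ((smoothRing_contDiffOn F).contDiffAt (hΩ.mem_nhds p.2)).differentiableAt (by simp)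

/-- The derivative along a constant vector, as a derivation of `smoothRing 𝕜 Ω`. -/
def pdiff (𝕜 : Type*) [RCLike 𝕜] {E : Type*} [NormedAddCommGroup E] [NormedSpace 𝕜 E]
    {Ω : Set E} (hΩ : IsOpen Ω) (v : E) :
    Derivation 𝕜 (smoothRing 𝕜 Ω) (smoothRing 𝕜 Ω) where
  toFun F := toSmooth (fun p => fderiv 𝕜 (extendZero F.1) p v)
    ((smoothRing_contDiffOn F).fderiv_apply_const hΩ v)
  map_add' F G := smoothRing_ext fun p => by
    have h : extendZero (F + G).1 =ᶠ[nhds p.1] extendZero F.1 + extendZero G.1 :=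
      extendZero_eventuallyEq hΩ p.2 fun q => by simp [extendZero_apply _ q.2]
    simp only [toSmooth_apply, h.fderiv_eq]
    rw [fderiv_add (smoothRing_differentiableAt hΩ F p) (smoothRing_differentiableAt hΩ G p)]
    rfl
  map_smul' c F := smoothRing_ext fun p => by
    have h : extendZero (c • F).1 =ᶠ[nhds p.1] c • extendZero F.1 :=
      extendZero_eventuallyEq hΩ p.2 fun q => by simp [extendZero_apply _ q.2]
    simp only [toSmooth_apply, h.fderiv_eq]
    rw [fderiv_const_smul (smoothRing_differentiableAt hΩ F p)]
    rfl
  map_one_eq_zero' := smoothRing_ext fun p => by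
    have h : extendZero (1 : smoothRing 𝕜 Ω).1 =ᶠ[nhds p.1] fun _ => 1 :=
      extendZero_eventuallyEq hΩ p.2 fun q => rfl
    change fderiv 𝕜 (extendZero (1 : smoothRing 𝕜 Ω).1) p v = 0
    rw [h.fderiv_eq]
    simp
  leibniz' F G := smoothRing_ext fun p => by
    have h : extendZero (F * G).1 =ᶠ[nhds p.1] extendZero F.1 * extendZero G.1 :=
      extendZero_eventuallyEq hΩ p.2 fun q => by simp [extendZero_apply _ q.2]
    change fderiv 𝕜 (extendZero (F * G).1) p v = F.1 p * fderiv 𝕜 (extendZero G.1) p v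
      + G.1 p * fderiv 𝕜 (extendZero F.1) p v
    rw [h.fderiv_eq, fderiv_mul (smoothRing_differentiableAt hΩ F p)
      (smoothRing_differentiableAt hΩ G p)]
    simp [extendZero_apply _ p.2]

lemma pdiff_apply {Ω : Set E} (hΩ : IsOpen Ω) (v : E) (F : smoothRing 𝕜 Ω) (p : Ω) :
    (pdiff 𝕜 hΩ v F).1 p = fderiv 𝕜 (extendZero F.1) p v := rfl

lemma pdiff_toSmooth {Ω : Set E} (hΩ : IsOpen Ω) (v : E) (F : E → 𝕜) (hF : ContDiffOn 𝕜 ∞ F Ω) :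
    pdiff 𝕜 hΩ v (toSmooth F hF)
      = toSmooth (fun p => fderiv 𝕜 F p v) (hF.fderiv_apply_const hΩ v) :=
  smoothRing_ext fun p => by
    rw [pdiff_apply, (extendZero_eventuallyEq hΩ p.2 fun q => rfl :
      extendZero (toSmooth F hF).1 =ᶠ[nhds p.1] F).fderiv_eq]
    rfl

lemma fderiv_fderiv_apply {F' : Type*} [NormedAddCommGroup F'] [NormedSpace 𝕜 F']
    {Ω : Set E} (hΩ : IsOpen Ω) {F : E → F'} (hF : ContDiffOn 𝕜 ∞ F Ω)
    {p : E} (hp : p ∈ Ω) (v w : E) :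
    fderiv 𝕜 (fun q => fderiv 𝕜 F q v) p w = fderiv 𝕜 (fderiv 𝕜 F) p w v := by
  have h : DifferentiableAt 𝕜 (fderiv 𝕜 F) p :=
    (((hF.fderiv_of_isOpen (m := ∞) hΩ (by simp)).contDiffAt (hΩ.mem_nhds hp)).differentiableAt
      (by simp))
  rw [fderiv_clm_apply h (differentiableAt_const v)]
  simp

lemma toSmooth_extendZero {Ω : Set E} (F : smoothRing 𝕜 Ω) :
    toSmooth (extendZero F.1) (smoothRing_contDiffOn F) = F :=
  smoothRing_ext fun p => by simp [extendZero_apply _ p.2]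

lemma pdiff_comm {Ω : Set E} (hΩ : IsOpen Ω) (v w : E) (F : smoothRing 𝕜 Ω) :
    pdiff 𝕜 hΩ v (pdiff 𝕜 hΩ w F) = pdiff 𝕜 hΩ w (pdiff 𝕜 hΩ v F) := by
  rw [← toSmooth_extendZero F]
  refine smoothRing_ext fun p => ?_
  simp only [pdiff_toSmooth, toSmooth_apply]
  rw [fderiv_fderiv_apply hΩ (smoothRing_contDiffOn F) p.2,
    fderiv_fderiv_apply hΩ (smoothRing_contDiffOn F) p.2]
  exact (((smoothRing_contDiffOn F).contDiffAt (hΩ.mem_nhds p.2)).isSymmSndFDerivAt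
    (by simpa using WithTop.coe_le_coe.2 (le_top : (2 : ℕ∞) ≤ ⊤))) v w

/-- A smooth function annihilated by a coordinate vanishes. -/
lemma smoothRing_eq_zero_of_mul_eq_zero {Ω : Set E} (hΩ : IsOpen Ω) {x F : smoothRing 𝕜 Ω} {v : E}
    (hx : pdiff 𝕜 hΩ v x = 1) (h : x * F = 0) : F = 0 := by
  have h' : pdiff 𝕜 hΩ v (x * F) = 0 := by rw [h, map_zero]
  rw [Derivation.leibniz, hx] at h'
  refine smoothRing_ext fun p => ?_
  have h1 : x.1 p * F.1 p = 0 := congrFun (congrArg Subtype.val h) p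
  have h2 : x.1 p * (pdiff 𝕜 hΩ v F).1 p + F.1 p * 1 = 0 := congrFun (congrArg Subtype.val h') p
  -- Where x = 0 the differentiated relation x ∂F + F = 0 reads F = 0; elsewhere x is invertible.
  rcases mul_eq_zero.1 h1 with h0 | h0
  · simpa [h0] using h2
  · exact h0

lemma smoothRing_eq_zero_of_natCast_mul {Ω : Set E} {n : ℕ} (hn : n ≠ 0) {F : smoothRing 𝕜 Ω}
    (h : (n : smoothRing 𝕜 Ω) * F = 0) : F = 0 := by
  refine smoothRing_ext fun p => ?_
  have h1 : (n : 𝕜) * F.1 p = 0 := congrFun (congrArg Subtype.val h) p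
  exact (mul_eq_zero.1 h1).resolve_left (by exact_mod_cast hn)

end SmoothRing

/-! ### Prolongation formulas over a ring with derivations -/

section DifferentialRing

variable {k R : Type*} [CommRing k] [CommRing R] [Algebra k R] {n m : ℕ}

/-- Total derivative `D_i F` in a ring with derivations `dx i`, `du α`, along first jets `q`. -/
def ringTotal (dx : Fin n → Derivation k R R) (du : Fin m → Derivation k R R)
    (q : Fin m → Fin n → R) (i : Fin n) (F : R) : R :=
  dx i F + ∑ α, q α i * du α F

/-- The second total derivative `D_j D_i F` with the first jets `q` treated as constants. -/
def ringTotal₂ (dx : Fin n → Derivation k R R) (du : Fin m → Derivation k R R)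
    (q : Fin m → Fin n → R) (i j : Fin n) (F : R) : R :=
  dx j (dx i F) + ∑ α, q α i * dx j (du α F)
    + ∑ β, q β j * (du β (dx i F) + ∑ α, q α i * du β (du α F))

/-- The contribution of the second jets `r` to `D_j D_i F`. -/
def ringVert (du : Fin m → Derivation k R R)
    (r : Fin m → Fin n → Fin n → R) (i j : Fin n) (F : R) : R :=
  ∑ α, r α i j * du α F

/-- First prolongation coefficients over a differential ring. -/
def ringProlong₁ (dx : Fin n → Derivation k R R) (du : Fin m → Derivation k R R)
    (ξ : Fin n → R) (η : Fin m → R) (q : Fin m → Fin n → R) (α : Fin m) (i : Fin n) : R :=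
  ringTotal dx du q i (η α) - ∑ j, q α j * ringTotal dx du q i (ξ j)

/-- Second prolongation coefficients over a differential ring. -/
def ringProlong₂ (dx : Fin n → Derivation k R R) (du : Fin m → Derivation k R R)
    (ξ : Fin n → R) (η : Fin m → R) (q : Fin m → Fin n → R) (r : Fin m → Fin n → Fin n → R)
    (α : Fin m) (i j : Fin n) : R :=
  ringTotal₂ dx du q i j (η α) + ringVert du r i j (η α)
    -- D_j applied to ∑ u_l D_i ξ^l by the product rule: u_l contributes u_{lj}, and D_i ξ^l
    -- contributes its second total derivative with both parts.
    - ∑ l, (r α l j * ringTotal dx du q i (ξ l)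
        + q α l * (ringTotal₂ dx du q i j (ξ l) + ringVert du r i j (ξ l)))
    - ∑ l, r α i l * ringTotal dx du q j (ξ l)

end DifferentialRing

/-! ### Comparison of analytic and algebraic prolongations -/

section Prolong

variable {𝕜 : Type*} [RCLike 𝕜] {n m : ℕ}

/-- The coordinate vector `∂/∂x^i`. -/
def xVec (𝕜 : Type*) [RCLike 𝕜] {n : ℕ} (m : ℕ) (i : Fin n) : TotalSpace 𝕜 n m :=
  (Pi.single i 1, 0)

/-- The coordinate vector `∂/∂u^α`. -/
def uVec (𝕜 : Type*) [RCLike 𝕜] (n : ℕ) {m : ℕ} (α : Fin m) : TotalSpace 𝕜 n m :=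
  (0, Pi.single α 1)

lemma totalSpace_eq_sum (a : Fin n → 𝕜) (b : Fin m → 𝕜) :
    ((a, b) : TotalSpace 𝕜 n m) = ∑ i, a i • xVec 𝕜 m i + ∑ α, b α • uVec 𝕜 n α := by
  ext i
  · simp [xVec, uVec, Prod.fst_sum, Finset.sum_apply, Pi.single_apply]
  · simp [xVec, uVec, Prod.snd_sum, Finset.sum_apply, Pi.single_apply]

lemma jetVec_eq_sum (i : Fin n) (b : Fin m → 𝕜) :
    ((Pi.single i 1, b) : TotalSpace 𝕜 n m) = xVec 𝕜 m i + ∑ α, b α • uVec 𝕜 n α := by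
  rw [totalSpace_eq_sum]
  simp [Pi.single_apply, ite_smul]

lemma vertVec_eq_sum (b : Fin m → 𝕜) :
    ((0, b) : TotalSpace 𝕜 n m) = ∑ α, b α • uVec 𝕜 n α := by
  rw [totalSpace_eq_sum]
  simp

/-- The coordinate `u^α_i` of a first jet. -/
def jetCoord (α : Fin m) (i : Fin n) : Jet1 𝕜 n m →L[𝕜] 𝕜 :=
  (ContinuousLinearMap.proj (R := 𝕜) (φ := fun _ : Fin n => 𝕜) i).comp
    ((ContinuousLinearMap.proj (R := 𝕜) (φ := fun _ : Fin m => Fin n → 𝕜) α).comp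
      (ContinuousLinearMap.snd 𝕜 (TotalSpace 𝕜 n m) (Fin m → Fin n → 𝕜)))

@[simp] lemma jetCoord_apply (α : Fin m) (i : Fin n) (q : Jet1 𝕜 n m) :
    jetCoord α i q = q.2 α i := rfl

/-- The second prolongation coefficients in terms of the first and second derivatives of `X`. -/
lemma prolong2_eq {Ω : Set (TotalSpace 𝕜 n m)} (hΩ : IsOpen Ω)
    {X : TotalSpace 𝕜 n m → TotalSpace 𝕜 n m} (hX : ContDiffOn 𝕜 ∞ X Ω) (α : Fin m) (i j : Fin n)
    (J : Jet2 𝕜 n m) (hJ : J.1.1 ∈ Ω) :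
    prolong2 X α i j J =
      fderiv 𝕜 (fderiv 𝕜 fun p => (X p).2 α) J.1.1
          (Pi.single j 1, fun β => J.1.2 β j) (Pi.single i 1, fun β => J.1.2 β i)
        + fderiv 𝕜 (fun p => (X p).2 α) J.1.1 (0, fun β => J.2 β i j)
        - ∑ l, (J.2 α l j * fderiv 𝕜 (fun p => (X p).1 l) J.1.1
              (Pi.single i 1, fun β => J.1.2 β i)
            + J.1.2 α l * (fderiv 𝕜 (fderiv 𝕜 fun p => (X p).1 l) J.1.1
                (Pi.single j 1, fun β => J.1.2 β j) (Pi.single i 1, fun β => J.1.2 β i)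
              + fderiv 𝕜 (fun p => (X p).1 l) J.1.1 (0, fun β => J.2 β i j)))
        - ∑ l, J.2 α i l * fderiv 𝕜 (fun p => (X p).1 l) J.1.1
            (Pi.single j 1, fun β => J.1.2 β j) := by
  -- D_i F is `fderiv F` at the base point, applied to a vector affine in the first jet. Its
  -- derivative has one term from moving the base point (F'') and one from moving the vector (the
  -- second jets).
  have key : ∀ F : TotalSpace 𝕜 n m → 𝕜, ContDiffOn 𝕜 ∞ F Ω →
      DifferentiableAt 𝕜 (totalDeriv0 F i) J.1 ∧ totalDeriv1 (totalDeriv0 F i) j J =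
        fderiv 𝕜 (fderiv 𝕜 F) J.1.1
          (Pi.single j 1, fun β => J.1.2 β j) (Pi.single i 1, fun β => J.1.2 β i)
        + fderiv 𝕜 F J.1.1 (0, fun β => J.2 β i j) := by
    intro F hF
    have h1 : HasFDerivAt (fun q : Jet1 𝕜 n m => fderiv 𝕜 F q.1)
        ((fderiv 𝕜 (fderiv 𝕜 F) J.1.1).comp (ContinuousLinearMap.fst 𝕜 _ _)) J.1 :=
      HasFDerivAt.comp J.1 (((hF.fderiv_of_isOpen (m := ∞) hΩ (by simp)).contDiffAt
        (hΩ.mem_nhds hJ)).differentiableAt (by simp)).hasFDerivAt hasFDerivAt_fst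
    let A : Jet1 𝕜 n m →L[𝕜] TotalSpace 𝕜 n m :=
      (0 : Jet1 𝕜 n m →L[𝕜] (Fin n → 𝕜)).prod (ContinuousLinearMap.pi fun β => jetCoord β i)
    have h2 : HasFDerivAt (fun q : Jet1 𝕜 n m =>
        ((Pi.single i 1, fun β => q.2 β i) : TotalSpace 𝕜 n m)) A J.1 := by
      have : (fun q : Jet1 𝕜 n m => ((Pi.single i 1, fun β => q.2 β i) : TotalSpace 𝕜 n m))
          = fun q => A q + (Pi.single i 1, 0) := by
        funext q
        simp [A]
      rw [this]
      exact A.hasFDerivAt.add_const _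
    have h3 := h1.clm_apply h2
    refine ⟨h3.differentiableAt, ?_⟩
    have h4 : fderiv 𝕜 (totalDeriv0 F i) J.1 = _ := h3.fderiv
    rw [totalDeriv1, h4]
    simp [A]
    rw [add_comm]
  have hη := key (fun p => (X p).2 α)
    (((contDiff_apply 𝕜 𝕜 α).comp contDiff_snd).comp_contDiffOn hX)
  have hξ := fun l => key (fun p => (X p).1 l)
    (((contDiff_apply 𝕜 𝕜 l).comp contDiff_fst).comp_contDiffOn hX)
  let c : Fin n → Jet1 𝕜 n m →L[𝕜] 𝕜 := fun l => jetCoord α l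
  have hd : HasFDerivAt (prolong1 X α i) _ J.1 := hη.1.hasFDerivAt.fun_sub
    (HasFDerivAt.fun_sum (u := Finset.univ) fun l _ => (c l).hasFDerivAt.mul (hξ l).1.hasFDerivAt)
  unfold prolong2
  rw [totalDeriv1, hd.fderiv]
  have h5 := hη.2
  have h6 := fun l => (hξ l).2
  unfold totalDeriv1 at h5 h6
  simp only [_root_.sub_apply, _root_.sum_apply,
    _root_.add_apply, _root_.smul_apply, h5, h6, smul_eq_mul]
  congr 2
  refine Finset.sum_congr rfl fun l _ => ?_
  simp [c, totalDeriv0]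
  ring

/-- Evaluation of smooth functions at a point. -/
def smoothEval {E : Type*} [NormedAddCommGroup E] [NormedSpace 𝕜 E] {Ω : Set E} (p : Ω) :
    smoothRing 𝕜 Ω →+* 𝕜 :=
  (Pi.evalRingHom _ p).comp (smoothRing 𝕜 Ω).val.toRingHom

@[simp] lemma smoothEval_toSmooth {E : Type*} [NormedAddCommGroup E] [NormedSpace 𝕜 E] {Ω : Set E}
    (p : Ω) (F : E → 𝕜) (hF : ContDiffOn 𝕜 ∞ F Ω) : smoothEval p (toSmooth F hF) = F p := rfl

variable {Ω : Set (TotalSpace 𝕜 n m)} (hΩ : IsOpen Ω)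

/-- The derivations `∂/∂x^i` of the smooth functions on `Ω`. -/
abbrev xDer (i : Fin n) : Derivation 𝕜 (smoothRing 𝕜 Ω) (smoothRing 𝕜 Ω) :=
  pdiff 𝕜 hΩ (xVec 𝕜 m i)

/-- The derivations `∂/∂u^α` of the smooth functions on `Ω`. -/
abbrev uDer (α : Fin m) : Derivation 𝕜 (smoothRing 𝕜 Ω) (smoothRing 𝕜 Ω) :=
  pdiff 𝕜 hΩ (uVec 𝕜 n α)

lemma smoothEval_pdiff (p : Ω) (v : TotalSpace 𝕜 n m) {F : TotalSpace 𝕜 n m → 𝕜}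
    (hF : ContDiffOn 𝕜 ∞ F Ω) :
    smoothEval p (pdiff 𝕜 hΩ v (toSmooth F hF)) = fderiv 𝕜 F p v := by
  rw [pdiff_toSmooth, smoothEval_toSmooth]

lemma smoothEval_pdiff_pdiff (p : Ω) (v w : TotalSpace 𝕜 n m) {F : TotalSpace 𝕜 n m → 𝕜}
    (hF : ContDiffOn 𝕜 ∞ F Ω) :
    smoothEval p (pdiff 𝕜 hΩ w (pdiff 𝕜 hΩ v (toSmooth F hF)))
      = fderiv 𝕜 (fderiv 𝕜 F) p w v := by
  rw [pdiff_toSmooth, pdiff_toSmooth, smoothEval_toSmooth, fderiv_fderiv_apply hΩ hF p.2]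

lemma smoothEval_ringTotal (p : Ω) {F : TotalSpace 𝕜 n m → 𝕜} (hF : ContDiffOn 𝕜 ∞ F Ω)
    (q : Fin m → Fin n → smoothRing 𝕜 Ω) (i : Fin n) :
    smoothEval p (ringTotal (xDer hΩ) (uDer hΩ) q i (toSmooth F hF))
      = fderiv 𝕜 F p (Pi.single i 1, fun β => smoothEval p (q β i)) := by
  rw [jetVec_eq_sum]
  simp [ringTotal, smoothEval_pdiff]

lemma smoothEval_ringTotal₂ (p : Ω) {F : TotalSpace 𝕜 n m → 𝕜} (hF : ContDiffOn 𝕜 ∞ F Ω)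
    (q : Fin m → Fin n → smoothRing 𝕜 Ω) (i j : Fin n) :
    smoothEval p (ringTotal₂ (xDer hΩ) (uDer hΩ) q i j (toSmooth F hF))
      = fderiv 𝕜 (fderiv 𝕜 F) p (Pi.single j 1, fun β => smoothEval p (q β j))
        (Pi.single i 1, fun β => smoothEval p (q β i)) := by
  rw [jetVec_eq_sum, jetVec_eq_sum]
  simp [ringTotal₂, smoothEval_pdiff_pdiff]

lemma smoothEval_ringVert (p : Ω) {F : TotalSpace 𝕜 n m → 𝕜} (hF : ContDiffOn 𝕜 ∞ F Ω)
    (r : Fin m → Fin n → Fin n → smoothRing 𝕜 Ω) (i j : Fin n) :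
    smoothEval p (ringVert (uDer hΩ) r i j (toSmooth F hF))
      = fderiv 𝕜 F p (0, fun β => smoothEval p (r β i j)) := by
  rw [vertVec_eq_sum]
  simp [ringVert, smoothEval_pdiff]

/-- The components of a smooth vector field along the independent variables. -/
def xCoeff {X : TotalSpace 𝕜 n m → TotalSpace 𝕜 n m} (hX : ContDiffOn 𝕜 ∞ X Ω) (i : Fin n) :
    smoothRing 𝕜 Ω :=
  toSmooth (fun p => (X p).1 i) (((contDiff_apply 𝕜 𝕜 i).comp contDiff_fst).comp_contDiffOn hX)

/-- The components of a smooth vector field along the dependent variables. -/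
def uCoeff {X : TotalSpace 𝕜 n m → TotalSpace 𝕜 n m} (hX : ContDiffOn 𝕜 ∞ X Ω) (α : Fin m) :
    smoothRing 𝕜 Ω :=
  toSmooth (fun p => (X p).2 α) (((contDiff_apply 𝕜 𝕜 α).comp contDiff_snd).comp_contDiffOn hX)

/-- The jet over `p` given by the values of a family of smooth functions. -/
def smoothJet (p : Ω) (q : Fin m → Fin n → smoothRing 𝕜 Ω)
    (r : Fin m → Fin n → Fin n → smoothRing 𝕜 Ω) : Jet2 𝕜 n m :=
  ((p, fun α i => smoothEval p (q α i)), fun α i j => smoothEval p (r α i j))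

lemma smoothEval_ringProlong₁ (p : Ω) {X : TotalSpace 𝕜 n m → TotalSpace 𝕜 n m}
    (hX : ContDiffOn 𝕜 ∞ X Ω) (q : Fin m → Fin n → smoothRing 𝕜 Ω) (α : Fin m) (i : Fin n) :
    smoothEval p (ringProlong₁ (xDer hΩ) (uDer hΩ) (xCoeff hX) (uCoeff hX) q α i)
      = prolong1 X α i (p, fun β j => smoothEval p (q β j)) := by
  simp [ringProlong₁, xCoeff, uCoeff, smoothEval_ringTotal, prolong1, totalDeriv0]

lemma smoothEval_ringProlong₂ (p : Ω) {X : TotalSpace 𝕜 n m → TotalSpace 𝕜 n m}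
    (hX : ContDiffOn 𝕜 ∞ X Ω) (q : Fin m → Fin n → smoothRing 𝕜 Ω)
    (r : Fin m → Fin n → Fin n → smoothRing 𝕜 Ω) (α : Fin m) (i j : Fin n) :
    smoothEval p (ringProlong₂ (xDer hΩ) (uDer hΩ) (xCoeff hX) (uCoeff hX) q r α i j)
      = prolong2 X α i j (smoothJet p q r) := by
  rw [prolong2_eq hΩ hX α i j _ p.2]
  simp [ringProlong₂, xCoeff, uCoeff, smoothEval_ringTotal, smoothEval_ringTotal₂,
    smoothEval_ringVert, smoothJet]

end Prolong

/-! ### Solving the determining equations of RKdV -/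

section RKdVRing

variable {k R : Type*} [CommRing k] [CommRing R] [Algebra k R]

lemma Derivation.map_ofNat_eq_zero (d : Derivation k R R) (n : ℕ) [n.AtLeastTwo] :
    d (ofNat(n) : R) = 0 := by
  exact_mod_cast d.map_natCast n

/-- The determining equations of the Lax pair of RKdV over a differential ring; `Mi` is the inverse
of `M`. -/
def RkdvDetermining (dx : Fin 3 → Derivation k R R) (du : Fin 2 → Derivation k R R)
    (lam M Mi Φ : R) (ξ : Fin 3 → R) (η : Fin 2 → R) : Prop :=
  -- The jets have entries in R, so they may vary with the point; this is needed because the Lax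
  -- pair expresses Φ_yy and Φ_T through λ, M, Φ.
  ∀ (q : Fin 2 → Fin 3 → R) (r : Fin 2 → Fin 3 → Fin 3 → R), (∀ α i j, r α i j = r α j i) →
    r 1 0 0 = -(q 0 0 * Mi) * q 1 0 + (Mi - lam * Mi ^ 2) * Φ →
    q 1 1 = (M ^ 2 * r 0 0 0 + M * q 0 0 ^ 2 - M ^ 2 + 4 * lam * M) * q 1 0 - M * q 0 0 * Φ →
    q 0 2 = 0 → r 0 0 2 = 0 → r 0 1 2 = 0 → r 0 2 2 = 0 →
    (ringProlong₂ dx du ξ η q r 1 0 0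
        + (ringProlong₁ dx du ξ η q 0 0 * Mi - q 0 0 * η 0 * Mi ^ 2) * q 1 0
        + q 0 0 * Mi * ringProlong₁ dx du ξ η q 1 0
        - (-η 0 * Mi ^ 2 - ξ 2 * Mi ^ 2 + 2 * lam * η 0 * Mi ^ 3) * Φ
        - (Mi - lam * Mi ^ 2) * η 1 = 0) ∧
    (ringProlong₁ dx du ξ η q 1 1
        - (2 * M * η 0 * r 0 0 0 + M ^ 2 * ringProlong₂ dx du ξ η q r 0 0 0
          + η 0 * q 0 0 ^ 2 + 2 * M * q 0 0 * ringProlong₁ dx du ξ η q 0 0 - 2 * M * η 0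
          + 4 * ξ 2 * M + 4 * lam * η 0) * q 1 0
        - (M ^ 2 * r 0 0 0 + M * q 0 0 ^ 2 - M ^ 2 + 4 * lam * M) * ringProlong₁ dx du ξ η q 1 0
        + η 0 * q 0 0 * Φ + M * ringProlong₁ dx du ξ η q 0 0 * Φ + M * q 0 0 * η 1 = 0) ∧
    ringProlong₁ dx du ξ η q 0 2 = 0 ∧ ringProlong₂ dx du ξ η q r 0 0 2 = 0 ∧
    ringProlong₂ dx du ξ η q r 0 1 2 = 0 ∧ ringProlong₂ dx du ξ η q r 0 2 2 = 0

/-- Write ξ = (Y, T, L) and η = (N, H), subscripts denoting derivatives; hypothesis names follow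
this, e.g. `hNl` is N_λ = 0. The M_λ condition frees N, Y, T of λ and Φ. The Φ_yy condition then
gives the shape of N, H, L up to Y_y and N_M, and the Φ_T condition ties N_M and T_T to Y_y. -/
theorem rkdv_core {dx : Fin 3 → Derivation k R R} {du : Fin 2 → Derivation k R R}
    (hxx : ∀ i j F, dx i (dx j F) = dx j (dx i F)) (hxu : ∀ i α F, dx i (du α F) = du α (dx i F))
    (huu : ∀ i j F, du i (du j F) = du j (du i F))
    {lam M Mi Φ : R} (hMi : M * Mi = 1)
    (hlx : ∀ i, dx i lam = if i = 2 then 1 else 0) (hlu : ∀ α, du α lam = 0)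
    (hMx : ∀ i, dx i M = 0) (hMu : ∀ α, du α M = if α = 0 then 1 else 0)
    (hPu : ∀ α, du α Φ = if α = 1 then 1 else 0)
    (cl : ∀ F, lam * F = 0 → F = 0) (cP : ∀ F, Φ * F = 0 → F = 0)
    (c2 : ∀ F : R, 2 * F = 0 → F = 0) 
    {ξ : Fin 3 → R} {η : Fin 2 → R} (h : RkdvDetermining dx du lam M Mi Φ ξ η) :
    ((∀ i, dx i (dx 0 (ξ 0)) = 0) ∧ ∀ α, du α (dx 0 (ξ 0)) = 0) ∧
    (dx 1 (ξ 0) = 0 ∧ dx 2 (ξ 0) = 0 ∧ ∀ α, du α (ξ 0) = 0) ∧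
    (dx 0 (ξ 1) = 0 ∧ dx 1 (ξ 1) = -3 * dx 0 (ξ 0) ∧ dx 2 (ξ 1) = 0 ∧ ∀ α, du α (ξ 1) = 0) ∧
    ξ 2 = 2 * lam * dx 0 (ξ 0) ∧ η 0 = 2 * M * dx 0 (ξ 0) ∧ η 1 = Φ * du 1 (η 1) ∧
    dx 0 (du 1 (η 1)) = 0 ∧ dx 1 (du 1 (η 1)) = 0 ∧ ∀ α, du α (du 1 (η 1)) = 0 := by
  -- Solution jets with seven free coordinates; Φ_yy and Φ_T come from the Lax pair and the other
  -- entries are 0. The conditions are polynomial in the free coordinates, so differences of values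
  -- at 0, 1 and -1 isolate coefficients.
  have hj : ∀ My MT Py Pl Myy PyT Pyl : R, _ := fun My MT Py Pl Myy PyT Pyl =>
    h ![![My, MT, 0], ![Py, (M ^ 2 * Myy + M * My ^ 2 - M ^ 2 + 4 * lam * M) * Py - M * My * Φ, Pl]]
      ![![![Myy, 0, 0], ![0, 0, 0], ![0, 0, 0]],
        ![![-(My * Mi) * Py + (Mi - lam * Mi ^ 2) * Φ, PyT, Pyl], ![PyT, 0, 0], ![Pyl, 0, 0]]]
      (by intro α i j; fin_cases α <;> fin_cases i <;> fin_cases j <;> rfl)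
      (by simp) (by simp) rfl rfl rfl rfl
  simp only [ringProlong₂, ringProlong₁, ringVert, ringTotal, ringTotal₂, Fin.sum_univ_succ,
    Fin.isValue, Matrix.cons_val_zero, Matrix.cons_val_one, Matrix.cons_val, Finset.univ_eq_empty,
    Finset.sum_empty, Fin.succ_zero_eq_one, Fin.succ_one_eq_two, add_zero, zero_mul] at hj
  have h1 := fun My MT Py Pl Myy PyT Pyl => (hj My MT Py Pl Myy PyT Pyl).1
  have h2 := fun My MT Py Pl Myy PyT Pyl => (hj My MT Py Pl Myy PyT Pyl).2.1
  have h3 := fun My MT Pl => (hj My MT 0 Pl 0 0 0).2.2.1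
  clear hj
  have hNl : dx 2 (η 0) = 0 := by linear_combination h3 0 0 0
  have hNP : du 1 (η 0) = 0 := by linear_combination h3 0 0 1 - h3 0 0 0
  have hYl : dx 2 (ξ 0) = 0 := by linear_combination h3 0 0 0 - h3 1 0 0
  have hYP : du 1 (ξ 0) = 0 := by linear_combination h3 0 0 1 - h3 1 0 1 - hYl
  have hTl : dx 2 (ξ 1) = 0 := by linear_combination h3 0 0 0 - h3 0 1 0
  have hTP : du 1 (ξ 1) = 0 := by linear_combination h3 0 0 1 - h3 0 1 1 - hTl
  clear h3
  simp only [← hxu, hNP, hYP, hTP, huu 1 0, map_zero, mul_zero, add_zero, zero_add] at h1 h2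
  -- Φ_yT enters the Φ_yy condition only through -2 Φ_yT D_y T, and Φ_yλ only through -2 Φ_yλ D_y L.
  -- Hence D_y T = D_y L = 0 for all values of M_y and Φ_y.
  have hTy : dx 0 (ξ 1) = 0 := c2 _ (by
    linear_combination h1 0 0 0 0 0 0 0 - h1 0 0 0 0 0 1 0)
  have hTM : du 0 (ξ 1) = 0 := c2 _ (by
    linear_combination h1 1 0 0 0 0 0 0 - h1 1 0 0 0 0 1 0 - 2 * hTy)
  have hLy : dx 0 (ξ 2) = 0 := c2 _ (by
    linear_combination h1 0 0 0 0 0 0 0 - h1 0 0 0 0 0 0 1)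
  have hLM : du 0 (ξ 2) = 0 := c2 _ (by
    linear_combination h1 1 0 0 0 0 0 0 - h1 1 0 0 0 0 0 1 - 2 * hLy)
  have hLP : du 1 (ξ 2) = 0 := c2 _ (by
    linear_combination h1 0 0 1 0 0 0 0 - h1 0 0 1 0 0 0 1 - 2 * hLy)
  simp only [hTy, hTM, hLy, hLM, hLP, map_zero, mul_zero, add_zero] at h1 h2
  have hHM : du 0 (η 1) = 0 := by
    linear_combination h1 0 0 0 0 1 0 0 - h1 0 0 0 0 0 0 0
  have hYM : du 0 (ξ 0) = 0 := by
    linear_combination hHM - h1 0 0 1 0 1 0 0 + h1 0 0 1 0 0 0 0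
  simp only [huu 0 1, hHM, hYM, map_zero, mul_zero, add_zero, zero_add] at h1 h2
  have hHPP : du 1 (du 1 (η 1)) = 0 := c2 _ (by
    linear_combination h1 0 0 1 0 0 0 0 + h1 0 0 (-1) 0 0 0 0 - 2 * h1 0 0 0 0 0 0 0)
  have cM : ∀ F : R, M * F = 0 → F = 0 := fun F hF => by
    linear_combination Mi * hF - F * hMi
  have hHy : dx 0 (η 1) = 0 := by
    linear_combination M * (h1 1 0 0 0 0 0 0 - h1 0 0 0 0 0 0 0) - dx 0 (η 1) * hMi
  -- The coefficient of M_y Φ_y, multiplied by M²: N is homogeneous of degree one in M.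
  have hN : M * du 0 (η 0) = η 0 := by
    linear_combination M ^ 2 * (h1 1 0 1 0 0 0 0 - h1 1 0 0 0 0 0 0 - h1 0 0 1 0 0 0 0
      + h1 0 0 0 0 0 0 0) + (-M * du 0 (η 0) + η 0 * (M * Mi + 1)) * hMi
  have hHyP : dx 0 (du 1 (η 1)) = 0 := by rw [hxu, hHy, map_zero]
  have hNy : dx 0 (η 0) = M * dx 0 (dx 0 (ξ 0)) := by
    linear_combination M * (h1 0 0 1 0 0 0 0 - h1 0 0 0 0 0 0 0) - 2 * M * hHyP - M * hHPP
      - dx 0 (η 0) * hMi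
  have haM : du 0 (du 0 (η 0)) = 0 := cM _ (by
    have := congrArg (du 0) hN
    simp only [Derivation.leibniz, hMu, smul_eq_mul, if_true] at this
    linear_combination this)
  have hay : dx 0 (du 0 (η 0)) = dx 0 (dx 0 (ξ 0)) := by
    refine sub_eq_zero.1 (cM _ ?_)
    have := congrArg (dx 0) hN
    simp only [Derivation.leibniz, hMx, smul_eq_mul] at this
    linear_combination this + hNy
  have hal : dx 2 (du 0 (η 0)) = 0 := by rw [hxu, hNl, map_zero]
  -- The Φ_yy condition at M_y = Φ_y = 0, times M². It is affine in M, so ∂_M yields `hG`, and what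
  -- is left over yields L = λ N_M. As L_y = 0, also λ N_My = 0.
  have h0 : (M - lam) * (Φ * du 1 (η 1) - η 1 - 2 * dx 0 (ξ 0) * Φ)
      + (du 0 (η 0) * M + ξ 2 - 2 * lam * du 0 (η 0)) * Φ = 0 := by
    have := h1 0 0 0 0 0 0 0
    rw [← hN, hHy, map_zero] at this
    grind
  have hG : Φ * du 1 (η 1) - η 1 - 2 * dx 0 (ξ 0) * Φ + du 0 (η 0) * Φ = 0 := by
    have := congrArg (du 0) h0
    simp [Derivation.map_ofNat_eq_zero, ← hxu, huu 0 1, hHM, hYM, hLM, hlu, hMu, hPu, haM] at this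
    linear_combination this
  have hL : ξ 2 = lam * du 0 (η 0) :=
    sub_eq_zero.1 (cP _ (by linear_combination h0 - (M - lam) * hG))
  have hay0 : dx 0 (du 0 (η 0)) = 0 := cl _ (by
    have := congrArg (dx 0) hL
    simp [hlx, hLy] at this
    exact this.symm)
  have hYyy : dx 0 (dx 0 (ξ 0)) = 0 := by rw [← hay, hay0]
  have hLT : dx 1 (ξ 2) = 0 := by
    linear_combination h2 0 0 0 0 0 0 0 - h2 0 0 0 1 0 0 0
  rw [hYyy, mul_zero] at hNy
  simp only [hLT, hay0, haM, hNy, hYyy, hHy, map_zero, mul_zero, add_zero, zero_add] at h2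
  have hTT : dx 1 (ξ 1) = 3 * dx 0 (ξ 0) - 3 * du 0 (η 0) := by
    refine sub_eq_zero.1 (cM _ (cM _ ?_))
    linear_combination -h2 0 0 1 0 1 0 0 + h2 0 0 1 0 0 0 0 + 2 * M * hN
  have hc0 : (-M ^ 2 + 4 * lam * M) * (du 0 (η 0) - 2 * dx 0 (ξ 0)) = dx 1 (ξ 0) := by
    linear_combination h2 0 0 1 0 0 0 0 - h2 0 0 0 0 0 0 0
      + (-M ^ 2 + 4 * lam * M) * hTT + 4 * M * hL + (2 * M - 4 * lam) * hN
  -- In `hc0` only the factor -M² + 4 λ M depends on λ, so ∂_λ leaves 4 M (N_M - 2 Y_y) = 0.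
  have hc : du 0 (η 0) = 2 * dx 0 (ξ 0) := by
    refine sub_eq_zero.1 (c2 _ (c2 _ (cM _ ?_)))
    have := congrArg (dx 2) hc0
    rw [hxx 2 1, hYl, map_zero] at this
    simp [Derivation.map_ofNat_eq_zero, hlx, hMx, hal, hxx 2 0, hYl] at this
    linear_combination this
  have hYT : dx 1 (ξ 0) = 0 := by rw [← hc0, hc, sub_self, mul_zero]
  have hH : η 1 = Φ * du 1 (η 1) := by
    linear_combination -hG + Φ * hc
  have hHT : dx 1 (η 1) = 0 := by
    linear_combination h2 0 0 0 0 0 0 0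
  refine ⟨⟨?_, ?_⟩, ⟨hYT, hYl, ?_⟩, ⟨hTy, ?_, hTl, ?_⟩, ?_, ?_, hH, hHyP, ?_, ?_⟩
  · intro i
    rw [hxx]
    fin_cases i <;> simp [hYyy, hYT, hYl]
  · intro α
    rw [← hxu]
    fin_cases α <;> simp [hYM, hYP]
  · intro α
    fin_cases α <;> simp [hYM, hYP]
  · rw [hTT, hc]
    ring
  · intro α
    fin_cases α <;> simp [hTM, hTP]
  · rw [hL, hc]
    ring
  · rw [← hN, hc]
    ring
  · rw [hxu, hHT, map_zero]
  · intro α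
    fin_cases α
    · simp [huu 0 1, hHM]
    · exact hHPP
end RKdVRing

/-! ### Solving the determining equations of RmKdV -/

section RmKdVRing

variable {k R : Type*} [CommRing k] [CommRing R] [Algebra k R]

/-- The determining equations of the Lax pair of RmKdV over a differential ring; `Ui` is the inverse
of `U`. -/
def RmkdvDetermining (dx : Fin 3 → Derivation k R R) (du : Fin 3 → Derivation k R R)
    (l U Ui P Q : R) (ξ : Fin 3 → R) (η : Fin 3 → R) : Prop :=
  ∀ (q : Fin 3 → Fin 3 → R) (r : Fin 3 → Fin 3 → Fin 3 → R), (∀ α i j, r α i j = r α j i) →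
    q 1 0 = -P + l * Ui * Q → q 2 0 = l * Ui * P + Q →
    q 1 1 = l * (4 * l * U * P
      + (U * r 0 0 0 + q 0 0 ^ 2 - 2 * U * q 0 0 - 4 * l ^ 2) * Q) →
    q 2 1 = l * ((U * r 0 0 0 + q 0 0 ^ 2 + 2 * U * q 0 0 - 4 * l ^ 2) * P
      - 4 * l * U * Q) →
    q 0 2 = 0 → r 0 0 2 = 0 → r 0 1 2 = 0 → r 0 2 2 = 0 →
    (ringProlong₁ dx du ξ η q 1 0 + η 1 - l * Ui * η 2 - (ξ 2 * Ui - l * η 0 * Ui ^ 2) * Q = 0) ∧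
    (ringProlong₁ dx du ξ η q 2 0 - η 2 - l * Ui * η 1 - (ξ 2 * Ui - l * η 0 * Ui ^ 2) * P = 0) ∧
    (ringProlong₁ dx du ξ η q 1 1
      - ξ 2 * (8 * l * U * P + (U * r 0 0 0 + q 0 0 ^ 2 - 2 * U * q 0 0 - 12 * l ^ 2) * Q)
      - l * (4 * l * η 0 * P + 4 * l * U * η 1
        + (η 0 * r 0 0 0 + U * ringProlong₂ dx du ξ η q r 0 0 0
          + 2 * q 0 0 * ringProlong₁ dx du ξ η q 0 0 - 2 * η 0 * q 0 0
          - 2 * U * ringProlong₁ dx du ξ η q 0 0) * Q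
        + (U * r 0 0 0 + q 0 0 ^ 2 - 2 * U * q 0 0 - 4 * l ^ 2) * η 2) = 0) ∧
    (ringProlong₁ dx du ξ η q 2 1
      - ξ 2 * ((U * r 0 0 0 + q 0 0 ^ 2 + 2 * U * q 0 0 - 12 * l ^ 2) * P - 8 * l * U * Q)
      - l * ((η 0 * r 0 0 0 + U * ringProlong₂ dx du ξ η q r 0 0 0
          + 2 * q 0 0 * ringProlong₁ dx du ξ η q 0 0 + 2 * η 0 * q 0 0
          + 2 * U * ringProlong₁ dx du ξ η q 0 0) * P
        + (U * r 0 0 0 + q 0 0 ^ 2 + 2 * U * q 0 0 - 4 * l ^ 2) * η 1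
        - 4 * l * η 0 * Q - 4 * l * U * η 2) = 0) ∧
    ringProlong₁ dx du ξ η q 0 2 = 0 ∧ ringProlong₂ dx du ξ η q r 0 0 2 = 0 ∧
    ringProlong₂ dx du ξ η q r 0 1 2 = 0 ∧ ringProlong₂ dx du ξ η q r 0 2 2 = 0

/-- A polynomial in a coordinate whose coefficients do not depend on it vanishes only if its
coefficients do. -/
lemma cubic_coeffs_eq_zero {d : Derivation k R R} {U : R} (hU : d U = 1)
    (c2 : ∀ F : R, 2 * F = 0 → F = 0) (c3 : ∀ F : R, 3 * F = 0 → F = 0) {a b c e : R}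
    (ha : d a = 0) (hb : d b = 0) (hc : d c = 0) (he : d e = 0)
    (h : a + b * U + c * U ^ 2 + e * U ^ 3 = 0) : a = 0 ∧ b = 0 ∧ c = 0 ∧ e = 0 := by
  have d1 : b + 2 * c * U + 3 * e * U ^ 2 = 0 := by
    have := congrArg d h
    simp [hU, ha, hb, hc, he, Derivation.leibniz_pow] at this
    linear_combination this
  have d2 : 2 * c + 6 * e * U = 0 := by
    have := congrArg d d1
    simp [hU, hb, hc, he, Derivation.leibniz_pow, Derivation.map_ofNat_eq_zero] at this
    linear_combination this
  have d3 : 6 * e = 0 := by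
    have := congrArg d d2
    simp [hU, hc, he, Derivation.map_ofNat_eq_zero] at this
    linear_combination this
  have e0 : e = 0 := c2 _ (c3 _ (by linear_combination d3))
  have c0 : c = 0 := c2 _ (by linear_combination d2 - 6 * U * e0)
  have b0 : b = 0 := by linear_combination d1 - 2 * U * c0 - 3 * U ^ 2 * e0
  exact ⟨by linear_combination h - U * b0 - U ^ 2 * c0 - U ^ 3 * e0, b0, c0, e0⟩

-- Write ξ = (Z, T, L), η = (N, H, K), b = N_U and W = L + Λ (Z_z - b). Once the dependence on U is
-- known, the conditions split by powers of U. What resists is a possible mixing H_Q of the two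
-- Ψ-components: 4 P H_Q = κ Q with κ built from Z and b. Cross-differentiating this relation with
-- the formulas for H_z and H_τ forces W = 0, then b_z = 0, Z_z = 0 and H_Q = 0.
set_option maxHeartbeats 1000000 in
theorem rmkdv_core {dx : Fin 3 → Derivation k R R} {du : Fin 3 → Derivation k R R}
    (hxx : ∀ i j F, dx i (dx j F) = dx j (dx i F)) (hxu : ∀ i α F, dx i (du α F) = du α (dx i F))
    (huu : ∀ i j F, du i (du j F) = du j (du i F))
    {l U Ui P Q : R} (hUi : U * Ui = 1)
    (hlx : ∀ i, dx i l = if i = 2 then 1 else 0) (hlu : ∀ α, du α l = 0)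
    (hUx : ∀ i, dx i U = 0) (hUu : ∀ α, du α U = if α = 0 then 1 else 0)
    (hPx : ∀ i, dx i P = 0) (hPu : ∀ α, du α P = if α = 1 then 1 else 0)
    (hQx : ∀ i, dx i Q = 0) (hQu : ∀ α, du α Q = if α = 2 then 1 else 0)
    (cl : ∀ F, l * F = 0 → F = 0) (cP : ∀ F, P * F = 0 → F = 0) (cQ : ∀ F, Q * F = 0 → F = 0)
    (c2 : ∀ F : R, 2 * F = 0 → F = 0) (c3 : ∀ F : R, 3 * F = 0 → F = 0)
    {ξ : Fin 3 → R} {η : Fin 3 → R} (h : RmkdvDetermining dx du l U Ui P Q ξ η) :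
    ((∀ i, dx i (du 0 (η 0)) = 0) ∧ ∀ α, du α (du 0 (η 0)) = 0) ∧
    ((∀ i, dx i (ξ 0) = 0) ∧ ∀ α, du α (ξ 0) = 0) ∧
    (dx 0 (ξ 1) = 0 ∧ dx 1 (ξ 1) = -3 * du 0 (η 0) ∧ dx 2 (ξ 1) = 0 ∧ ∀ α, du α (ξ 1) = 0) ∧
    ξ 2 = l * du 0 (η 0) ∧ η 0 = U * du 0 (η 0) ∧ η 1 = P * du 1 (η 1) ∧ η 2 = Q * du 1 (η 1) ∧
    dx 0 (du 1 (η 1)) = 0 ∧ dx 1 (du 1 (η 1)) = 0 ∧ ∀ α, du α (du 1 (η 1)) = 0 := by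
  have hj : ∀ Uz Ut Pl Ql Uzz : R, _ := fun Uz Ut Pl Ql Uzz =>
    h ![![Uz, Ut, 0], ![-P + l * Ui * Q, l * (4 * l * U * P
        + (U * Uzz + Uz ^ 2 - 2 * U * Uz - 4 * l ^ 2) * Q), Pl],
        ![l * Ui * P + Q, l * ((U * Uzz + Uz ^ 2 + 2 * U * Uz - 4 * l ^ 2) * P
          - 4 * l * U * Q), Ql]]
      -- Second derivatives of Ψ do not occur in the system, so they are set to 0.
      ![![![Uzz, 0, 0], ![0, 0, 0], ![0, 0, 0]], fun _ _ => 0, fun _ _ => 0]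
      (by intro α i j; fin_cases α <;> fin_cases i <;> fin_cases j <;> rfl)
      rfl rfl rfl rfl rfl rfl rfl rfl
  have h1 := fun Uz Ut Pl Ql Uzz => (hj Uz Ut Pl Ql Uzz).1
  have h1' := fun Uz => (hj Uz 0 0 0 0).2.1
  have h2 := fun Uz Ut Pl Ql Uzz => (hj Uz Ut Pl Ql Uzz).2.2.1
  have h3 := fun Uz Ut Pl Ql => (hj Uz Ut Pl Ql 0).2.2.2.2.1
  clear hj
  simp only [ringProlong₂, ringProlong₁, ringVert, ringTotal, ringTotal₂, Fin.sum_univ_succ,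
    Fin.isValue, Matrix.cons_val_zero, Matrix.cons_val_one, Matrix.cons_val, Finset.univ_eq_empty,
    Finset.sum_empty, Fin.succ_zero_eq_one, Fin.succ_one_eq_two, add_zero, zero_add, mul_zero,
    zero_mul] at h1 h1' h2 h3
  have hNl : dx 2 (η 0) = 0 := by linear_combination h3 0 0 0 0
  have hNP : du 1 (η 0) = 0 := by linear_combination h3 0 0 1 0 - h3 0 0 0 0
  have hNQ : du 2 (η 0) = 0 := by linear_combination h3 0 0 0 1 - h3 0 0 0 0
  have hZl : dx 2 (ξ 0) = 0 := by linear_combination h3 0 0 0 0 - h3 1 0 0 0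
  have hZP : du 1 (ξ 0) = 0 := by linear_combination h3 0 0 1 0 - h3 1 0 1 0 - hZl
  have hZQ : du 2 (ξ 0) = 0 := by linear_combination h3 0 0 0 1 - h3 1 0 0 1 - hZl
  have hTl : dx 2 (ξ 1) = 0 := by linear_combination h3 0 0 0 0 - h3 0 1 0 0
  have hTP : du 1 (ξ 1) = 0 := by linear_combination h3 0 0 1 0 - h3 0 1 1 0 - hTl
  have hTQ : du 2 (ξ 1) = 0 := by linear_combination h3 0 0 0 1 - h3 0 1 0 1 - hTl
  clear h3
  simp only [← hxu, huu 1 0, huu 2 0, hNP, hNQ, hZP, hZQ, hTP, hTQ, map_zero, mul_zero,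
    add_zero] at h1 h1' h2
  have cU : ∀ F : R, U * F = 0 → F = 0 := fun F hF => by
    linear_combination Ui * hF - F * hUi
  have hLU : du 0 (ξ 2) = 0 := by
    linear_combination h1 1 0 0 0 0 - h1 1 0 1 0 0 - h1 0 0 0 0 0 + h1 0 0 1 0 0
  -- Ψ₁_Λ occurs in the Ψ₁_τ condition through -Ψ₁_Λ D_τ L. The U_zz part and the part odd in U_z of
  -- D_τ L are two independent linear equations for L_P and L_Q.
  have hL1 : l * U * (Q * du 1 (ξ 2) + P * du 2 (ξ 2)) = 0 := by
    linear_combination h2 0 0 0 0 1 - h2 0 0 1 0 1 - h2 0 0 0 0 0 + h2 0 0 1 0 0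
  have hL2 : -4 * l * U * Q * du 1 (ξ 2) + 4 * l * U * P * du 2 (ξ 2) = 0 := by
    linear_combination h2 1 0 0 0 0 - h2 1 0 1 0 0 - h2 (-1) 0 0 0 0 + h2 (-1) 0 1 0 0
  have hLP : du 1 (ξ 2) = 0 := c2 _ (c2 _ (c2 _ (cl _ (cU _ (cQ _ (by
    linear_combination 4 * hL1 - hL2))))))
  have hLQ : du 2 (ξ 2) = 0 := cl _ (cU _ (cP _ (by
    linear_combination hL1 - l * U * Q * hLP)))
  have hLz : dx 0 (ξ 2) = 0 := by
    linear_combination h1 0 0 0 0 0 - h1 0 0 1 0 0 - (-P + l * Ui * Q) * hLP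
      - (l * Ui * P + Q) * hLQ
  simp only [hLU, hLP, hLQ, hLz, mul_zero, add_zero] at h1 h1' h2
  have hLt : dx 1 (ξ 2) = 0 := by
    linear_combination h2 0 0 0 0 0 - h2 0 0 1 0 0
  have hTz : dx 0 (ξ 1) = 0 := cl _ (cU _ (cQ _ (by
    linear_combination h1 0 0 0 0 0 - h1 0 0 0 0 1)))
  have hTU : du 0 (ξ 1) = 0 := cl _ (cU _ (cQ _ (by
    linear_combination h1 1 0 0 0 0 - h1 1 0 0 0 1 - l * U * Q * hTz)))
  simp only [hLt, hTz, hTU, map_zero, mul_zero, add_zero] at h1 h1' h2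
  -- Coefficient of U_z U_zz. The 3 counts Z_U twice from -2 U_zz D_z Z and once from the second
  -- total derivative of Z, all inside the prolongation of U_zz.
  have hZU : du 0 (ξ 0) = 0 := cl _ (cU _ (cQ _ (c3 _ (by
    linear_combination h2 1 0 0 0 1 - h2 1 0 0 0 0 - h2 0 0 0 0 1 + h2 0 0 0 0 0))))
  have hHU : du 0 (η 1) = 0 := by
    linear_combination h1 1 0 0 0 0 - h1 0 0 0 0 0 + (-P + l * Ui * Q) * hZU
  have hKU : du 0 (η 2) = 0 := by
    linear_combination h1' 1 - h1' 0 + (Q + l * Ui * P) * hZU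
  clear h1'
  simp only [hZU, hHU, map_zero, mul_zero, add_zero, zero_add] at h1 h2
  -- The Ψ₁_z condition times U²: apart from N it is quadratic in U with coefficients independent of
  -- U. Two U-derivatives (`hb`, `hc`) allow these coefficients to be eliminated.
  have ha : U ^ 2 * (dx 0 (η 1) - P * du 1 (η 1) + Q * du 2 (η 1) + P * dx 0 (ξ 0) + η 1)
      + U * (l * (Q * du 1 (η 1) + P * du 2 (η 1) - Q * dx 0 (ξ 0) - η 2) - ξ 2 * Q)
      + l * Q * η 0 = 0 := by
    have := h1 0 0 0 0 0
    grind
  have hb : 2 * U * (dx 0 (η 1) - P * du 1 (η 1) + Q * du 2 (η 1) + P * dx 0 (ξ 0) + η 1)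
      + (l * (Q * du 1 (η 1) + P * du 2 (η 1) - Q * dx 0 (ξ 0) - η 2) - ξ 2 * Q)
      + l * Q * du 0 (η 0) = 0 := by
    have := congrArg (du 0) ha
    simp [Derivation.leibniz_pow, ← hxu, huu 0 1, huu 0 2, hHU, hZU, hKU, hLU, hlu, hUu, hPu,
      hQu] at this
    linear_combination this
  have hc : 2 * (dx 0 (η 1) - P * du 1 (η 1) + Q * du 2 (η 1) + P * dx 0 (ξ 0) + η 1)
      + l * Q * du 0 (du 0 (η 0)) = 0 := by
    have := congrArg (du 0) hb
    simp [Derivation.map_ofNat_eq_zero, ← hxu, huu 0 1, huu 0 2, hHU, hZU, hKU, hLU, hlu, hUu, hPu,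
      hQu] at this
    linear_combination this
  -- The U_zz and U_z² coefficients of the Ψ₁_τ condition, combined so that everything except N
  -- cancels.
  have hN1 : η 0 - U * du 0 (η 0) - U ^ 2 * du 0 (du 0 (η 0)) = 0 := c2 _ (cl _ (cQ _ (by
    linear_combination -2 * (h2 0 0 0 0 1 - h2 0 0 0 0 0)
      + U * (h2 1 0 0 0 0 + h2 (-1) 0 0 0 0 - 2 * h2 0 0 0 0 0))))
  have hbU : du 0 (du 0 (η 0)) = 0 := c3 _ (cU _ (cU _ (cl _ (cQ _ (by
    linear_combination 2 * (ha - U * hb) + U ^ 2 * hc - 2 * l * Q * hN1)))))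
  have hN : η 0 = U * du 0 (η 0) := by linear_combination hN1 + U ^ 2 * hbU
  have hNz : dx 0 (η 0) = U * dx 0 (du 0 (η 0)) := by
    have := congrArg (dx 0) hN
    simpa [hUx] using this
  have hNzz : dx 0 (dx 0 (η 0)) = U * dx 0 (dx 0 (du 0 (η 0))) := by
    have := congrArg (dx 0) hNz
    simpa [hUx] using this
  have hA : dx 0 (η 1) - P * du 1 (η 1) + Q * du 2 (η 1) + P * dx 0 (ξ 0) + η 1 = 0 :=
    c2 _ (by linear_combination hc - l * Q * hbU)
  have hB : l * (Q * du 1 (η 1) + P * du 2 (η 1) - Q * dx 0 (ξ 0) - η 2) - ξ 2 * Q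
      + l * Q * du 0 (η 0) = 0 := by linear_combination hb - 2 * U * hA
  have hu : l * (Q * du 1 (η 1) + P * du 2 (η 1)) - l * Q * dx 1 (ξ 1) - ξ 2 * Q
      - l * (2 * du 0 (η 0) - 2 * dx 0 (ξ 0)) * Q - l * η 2 = 0 := cU _ (by
    linear_combination h2 0 0 0 0 1 - h2 0 0 0 0 0 + l * Q * hN)
  -- The part of the Ψ₁_τ condition odd in U_z; the factor in front of Q is κ.
  have hk : 4 * P * du 2 (η 1) =
      (4 * dx 0 (du 0 (η 0)) - dx 0 (dx 0 (ξ 0)) - 2 * dx 0 (ξ 0)) * Q := by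
    refine sub_eq_zero.1 (c2 _ (cl _ (cU _ ?_)))
    linear_combination h2 1 0 0 0 0 - h2 (-1) 0 0 0 0 + 4 * U * hu + 4 * l * Q * (hNz - hN)
  have hTt : dx 1 (ξ 1) = 3 * dx 0 (ξ 0) - 3 * du 0 (η 0) := by
    refine sub_eq_zero.1 (cl _ (cQ _ ?_))
    linear_combination hB - hu
  -- U times the Ψ₁_τ condition at zero free jet coordinates. With N = U b it is a cubic in U whose
  -- coefficients do not involve U.
  have hpoly := cubic_coeffs_eq_zero (d := du 0) (U := U) (by simp [hUu]) c2 c3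
    (a := -l * Q * dx 1 (ξ 0))
    (b := dx 1 (η 1) - 4 * l ^ 3 * (Q * du 1 (η 1) + P * du 2 (η 1)) + P * dx 1 (ξ 0)
      + 4 * l ^ 3 * Q * dx 1 (ξ 1) + 12 * l ^ 2 * ξ 2 * Q + 4 * l ^ 3 * η 2)
    (c := 4 * l ^ 2 * (P * du 1 (η 1) - Q * du 2 (η 1) - P * dx 1 (ξ 1) - du 0 (η 0) * P - η 1)
      - 8 * l * ξ 2 * P)
    (e := -l * Q * (dx 0 (dx 0 (du 0 (η 0))) - 2 * dx 0 (du 0 (η 0))))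
    (by simp [← hxu, hZU, hlu, hQu])
    (by simp [Derivation.map_ofNat_eq_zero, Derivation.leibniz_pow, ← hxu, huu 0 1, huu 0 2, hHU,
          hZU, hKU, hLU, hTU, hlu, hPu, hQu])
    (by simp [Derivation.map_ofNat_eq_zero, Derivation.leibniz_pow, ← hxu, huu 0 1, huu 0 2, hHU,
          hLU, hTU, hlu, hPu, hQu, hbU])
    (by simp [Derivation.map_ofNat_eq_zero, ← hxu, hlu, hQu, hbU])
    (by
      have := h2 0 0 0 0 0
      rw [hNzz, hNz] at this
      linear_combination U * this + l * Q * dx 1 (ξ 0) * hUi + 4 * l ^ 2 * P * U * hN)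
  obtain ⟨p0, p1, p2, p3⟩ := hpoly
  have hZt : dx 1 (ξ 0) = 0 := cl _ (cQ _ (by linear_combination -p0))
  have hbzz : dx 0 (dx 0 (du 0 (η 0))) = 2 * dx 0 (du 0 (η 0)) :=
    sub_eq_zero.1 (cl _ (cQ _ (by linear_combination -p3)))
  have hHt : dx 1 (η 1) = -8 * l ^ 2 * (ξ 2 + l * (dx 0 (ξ 0) - du 0 (η 0))) * Q := by
    linear_combination p1 + 4 * l ^ 2 * hu - P * hZt
  have hH2 : l * (P * du 1 (η 1) - Q * du 2 (η 1) - η 1)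
      = P * (2 * (ξ 2 + l * (dx 0 (ξ 0) - du 0 (η 0))) + l * dx 0 (ξ 0)) := by
    refine sub_eq_zero.1 (c2 _ (c2 _ (cl _ ?_)))
    linear_combination p2 + 4 * l ^ 2 * P * hTt
  have hHz : l * dx 0 (η 1) = 2 * P * (ξ 2 + l * (dx 0 (ξ 0) - du 0 (η 0))) := by
    linear_combination l * hA + hH2
  have hHzQ : dx 0 (du 2 (η 1)) = 0 := cl _ (by
    have := congrArg (du 2) hHz
    simp [Derivation.map_ofNat_eq_zero, ← hxu, huu 2 0, hlu, hPu, hLQ, hZQ, hNQ] at this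
    exact this)
  have hHtQ : dx 1 (du 2 (η 1)) = -8 * l ^ 2 * (ξ 2 + l * (dx 0 (ξ 0) - du 0 (η 0))) := by
    have := congrArg (du 2) hHt
    simp [Derivation.map_ofNat_eq_zero, Derivation.leibniz_pow, ← hxu, huu 2 0, hlu, hQu, hLQ, hZQ,
      hNQ] at this
    linear_combination this
  have hkz : 4 * dx 0 (dx 0 (du 0 (η 0))) - dx 0 (dx 0 (dx 0 (ξ 0))) - 2 * dx 0 (dx 0 (ξ 0)) = 0 :=
    cQ _ (by
      have := congrArg (dx 0) hk
      simp [Derivation.map_ofNat_eq_zero, hPx, hQx, hHzQ] at this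
      linear_combination -this)
  have hkt : -32 * l ^ 2 * (ξ 2 + l * (dx 0 (ξ 0) - du 0 (η 0))) * P
      = dx 1 (4 * dx 0 (du 0 (η 0)) - dx 0 (dx 0 (ξ 0)) - 2 * dx 0 (ξ 0)) * Q := by
    have := congrArg (dx 1) hk
    rw [Derivation.leibniz, Derivation.leibniz, Derivation.leibniz, hHtQ, hPx, hQx] at this
    simp [Derivation.map_ofNat_eq_zero] at this
    simp [Derivation.map_ofNat_eq_zero]
    linear_combination this
  -- `hkt` says -32 Λ² W P = κ_τ Q, where neither W nor κ depends on P; apply ∂_P.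
  have hW : ξ 2 + l * (dx 0 (ξ 0) - du 0 (η 0)) = 0 := by
    refine c2 _ (c2 _ (c2 _ (c2 _ (c2 _ (cl _ (cl _ ?_))))))
    have := congrArg (du 1) hkt
    simp [Derivation.map_ofNat_eq_zero, Derivation.leibniz_pow, ← hxu, huu 1 0, hlu, hPu, hQu, hLP,
      hZP, hNP] at this
    linear_combination this
  have hZzz : dx 0 (dx 0 (ξ 0)) = dx 0 (du 0 (η 0)) := by
    refine sub_eq_zero.1 (cl _ ?_)
    have := congrArg (dx 0) hW
    simp [hLz, hlx] at this
    linear_combination this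
  have hbt : dx 1 (du 0 (η 0)) = 0 := cl _ (by
    have := congrArg (dx 1) hW
    simp [hLt, hlx, hxx 1 0, hZt] at this
    exact this)
  -- With Z_zz = b_z and b_zz = 2 b_z, the relation κ_z = 0 becomes (8 - 2 - 2) b_z = 0.
  have hbz : dx 0 (du 0 (η 0)) = 0 := by
    rw [hZzz, hbzz] at hkz
    exact c2 _ (c2 _ (by linear_combination hkz))
  rw [hbz] at hZzz
  rw [hbz, hZzz] at hk
  have hk' : 2 * (P * du 2 (η 1)) = -dx 0 (ξ 0) * Q :=
    sub_eq_zero.1 (c2 _ (by linear_combination hk))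
  have hH3 : P * du 1 (η 1) - Q * du 2 (η 1) - η 1 = P * dx 0 (ξ 0) :=
    sub_eq_zero.1 (cl _ (by linear_combination hH2 + 2 * P * hW))
  have hk1 : P * du 1 (du 2 (η 1)) = -du 2 (η 1) := by
    refine sub_eq_zero.1 (c2 _ ?_)
    have := congrArg (du 1) hk'
    simp [Derivation.map_ofNat_eq_zero, ← hxu, hPu, hQu, hZP] at this
    linear_combination this
  have hk2 : 2 * P * du 2 (du 2 (η 1)) = -dx 0 (ξ 0) := by
    have := congrArg (du 2) hk'
    simp [Derivation.map_ofNat_eq_zero, ← hxu, hPu, hQu, hZQ] at this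
    linear_combination this
  have hk3 : P * du 1 (du 2 (η 1)) - 2 * du 2 (η 1) - Q * du 2 (du 2 (η 1)) = 0 := by
    have := congrArg (du 2) hH3
    simp [← hxu, huu 2 1, hPu, hQu, hZQ] at this
    linear_combination this
  -- By `hk'`, H_Q behaves like -Z_z Q / (2 P). This is compatible with `hk3`, the Q-derivative of
  -- `hH3`, only if 4 Q Z_z = 0.
  have he : dx 0 (ξ 0) = 0 := c2 _ (c2 _ (cQ _ (by
    linear_combination 2 * P * hk3 - 2 * P * hk1 + Q * hk2 + 3 * hk')))
  have hHQ : du 2 (η 1) = 0 := c2 _ (cP _ (by linear_combination hk' - Q * he))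
  rw [he, mul_zero, hHQ, mul_zero, sub_zero] at hH3
  have hH : η 1 = P * du 1 (η 1) := by linear_combination -hH3
  have hL : ξ 2 = l * du 0 (η 0) := by linear_combination hW - l * he
  have hK : η 2 = Q * du 1 (η 1) := by
    refine sub_eq_zero.1 (cl _ ?_)
    linear_combination -hB + l * P * hHQ - l * Q * he - Q * hL
  have hHz' : dx 0 (η 1) = 0 := cl _ (by rw [hHz, hW, mul_zero])
  rw [hW, mul_zero, zero_mul] at hHt
  refine ⟨⟨?_, ?_⟩, ⟨?_, ?_⟩, ⟨hTz, by rw [hTt, he]; ring, hTl, ?_⟩, hL, hN, hH, hK, ?_, ?_, ?_⟩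
  · intro i
    fin_cases i
    · exact hbz
    · exact hbt
    · simp [hxu, hNl]
  · intro α
    fin_cases α
    · exact hbU
    · simp [huu 1 0, hNP]
    · simp [huu 2 0, hNQ]
  · intro i
    fin_cases i
    exacts [he, hZt, hZl]
  · intro α
    fin_cases α
    exacts [hZU, hZP, hZQ]
  · intro α
    fin_cases α
    exacts [hTU, hTP, hTQ]
  · rw [hxu, hHz', map_zero]
  · rw [hxu, hHt, map_zero]
  · intro α
    fin_cases α
    · simp [huu 0 1, hHU]
    · refine cP _ ?_
      have := congrArg (du 1) hH
      simp [hPu] at this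
      exact this
    · simp [huu 2 1, hHQ]

end RmKdVRing

/-! ### The claimed fields satisfy the determining equations -/

section Converse

variable {k R : Type*} [CommRing k] [CommRing R] [Algebra k R]

theorem rkdvDetermining_of_eq {dx : Fin 3 → Derivation k R R} {du : Fin 2 → Derivation k R R}
    {lam M Mi Φ : R} (hMi : M * Mi = 1)
    (hlx : ∀ i, dx i lam = if i = 2 then 1 else 0) (hlu : ∀ α, du α lam = 0)
    (hMx : ∀ i, dx i M = 0) (hMu : ∀ α, du α M = if α = 0 then 1 else 0)
    (hPx : ∀ i, dx i Φ = 0) (hPu : ∀ α, du α Φ = if α = 1 then 1 else 0)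
    {ξ : Fin 3 → R} {η : Fin 2 → R} {y T c f : R}
    (hcx : ∀ i, dx i c = 0) (hcu : ∀ α, du α c = 0)
    (hyx : ∀ i, dx i y = if i = 0 then c else 0) (hyu : ∀ α, du α y = 0)
    (hTx : ∀ i, dx i T = if i = 1 then -3 * c else 0) (hTu : ∀ α, du α T = 0)
    (hf0 : dx 0 f = 0) (hf1 : dx 1 f = 0) (hfu : ∀ α, du α f = 0)
    (hξ : ξ = ![y, T, 2 * c * lam]) (hη : η = ![2 * c * M, f * Φ]) :
    RkdvDetermining dx du lam M Mi Φ ξ η := by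
  intro q r hr e1 e2 e3 e4 e5 e6
  subst hξ hη
  have e4' : r 0 2 0 = 0 := by rw [hr, e4]
  have e5' : r 0 2 1 = 0 := by rw [hr, e5]
  simp [ringProlong₂, ringProlong₁, ringVert, ringTotal, ringTotal₂, Fin.sum_univ_succ,
    Derivation.map_ofNat_eq_zero, hlx, hlu, hMx, hMu, hPx, hPu, hcx, hcu, hyx, hyu, hTx, hTu, hf0,
    hf1, hfu, e3, e4, e5, e6, e4', e5']
  rw [e1, e2]
  constructor
  · grind
  · ring

theorem rmkdvDetermining_of_eq {dx : Fin 3 → Derivation k R R} {du : Fin 3 → Derivation k R R}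
    {l U Ui P Q : R} (hUi : U * Ui = 1)
    (hlx : ∀ i, dx i l = if i = 2 then 1 else 0) (hlu : ∀ α, du α l = 0)
    (hUx : ∀ i, dx i U = 0) (hUu : ∀ α, du α U = if α = 0 then 1 else 0)
    (hPx : ∀ i, dx i P = 0) (hPu : ∀ α, du α P = if α = 1 then 1 else 0)
    (hQx : ∀ i, dx i Q = 0) (hQu : ∀ α, du α Q = if α = 2 then 1 else 0)
    {ξ : Fin 3 → R} {η : Fin 3 → R} {z t c g : R}
    (hcx : ∀ i, dx i c = 0) (hcu : ∀ α, du α c = 0)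
    (hzx : ∀ i, dx i z = 0) (hzu : ∀ α, du α z = 0)
    (htx : ∀ i, dx i t = if i = 1 then 3 * c else 0) (htu : ∀ α, du α t = 0)
    (hg0 : dx 0 g = 0) (hg1 : dx 1 g = 0) (hgu : ∀ α, du α g = 0)
    (hξ : ξ = ![z, t, -c * l]) (hη : η = ![-c * U, g * P, g * Q]) :
    RmkdvDetermining dx du l U Ui P Q ξ η := by
  intro q r hr e1 e2 e3 e4 e5 e6 e7 e8
  subst hξ hη
  have e6' : r 0 2 0 = 0 := by rw [hr, e6]
  have e7' : r 0 2 1 = 0 := by rw [hr, e7]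
  simp [ringProlong₂, ringProlong₁, ringVert, ringTotal, ringTotal₂, Fin.sum_univ_succ,
    Derivation.map_ofNat_eq_zero, hlx, hlu, hUx, hUu, hPx, hPu, hQx, hQu, hcx, hcu, hzx, hzu, htx,
    htu, hg0, hg1, hgu, e5, e6, e7, e8, e6', e7']
  rw [e1, e2, e3, e4]
  refine ⟨?_, ?_, ?_, ?_⟩
  · grind
  · grind
  · ring
  · ring

end Converse

/-! ### Differentials of the equations along arbitrary jet vectors -/

section Linearization

variable {𝕜 : Type*} [RCLike 𝕜] {n m : ℕ}

lemma fderiv_eq_of_hasDerivAt_line {E : Type*} [NormedAddCommGroup E] [NormedSpace 𝕜 E] {F : E → 𝕜}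
    {p v : E} {a : 𝕜} (hF : DifferentiableAt 𝕜 F p)
    (h : HasDerivAt (fun t : 𝕜 => F (p + t • v)) a 0) : fderiv 𝕜 F p v = a := by
  rw [← hF.lineDeriv_eq_fderiv]
  exact h.deriv

lemma hasDerivAt_add_mul (a w : 𝕜) : HasDerivAt (fun t : 𝕜 => a + t * w) w 0 := by
  simpa using ((hasDerivAt_id (0 : 𝕜)).mul_const w).const_add a

/-- Computed by restricting to the line J + t W and using one-variable rules. The result is written
with powers of M⁻¹, to match `RkdvDetermining` term by term when W is the prolongation. -/
lemma fderiv_rkdvLax {J : Jet2 𝕜 3 2} (hM : J.1.1.2 0 ≠ 0) (W : Jet2 𝕜 3 2) (ν : Fin 6) :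
    fderiv 𝕜 (rkdvLax ν) J W =
      ![W.2 1 0 0
          + (W.1.2 0 0 * (J.1.1.2 0)⁻¹ - J.1.2 0 0 * W.1.1.2 0 * (J.1.1.2 0)⁻¹ ^ 2) * J.1.2 1 0
          + J.1.2 0 0 * (J.1.1.2 0)⁻¹ * W.1.2 1 0
          - (-W.1.1.2 0 * (J.1.1.2 0)⁻¹ ^ 2 - W.1.1.1 2 * (J.1.1.2 0)⁻¹ ^ 2
              + 2 * J.1.1.1 2 * W.1.1.2 0 * (J.1.1.2 0)⁻¹ ^ 3) * J.1.1.2 1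
          - ((J.1.1.2 0)⁻¹ - J.1.1.1 2 * (J.1.1.2 0)⁻¹ ^ 2) * W.1.1.2 1,
        W.1.2 1 1
          - (2 * J.1.1.2 0 * W.1.1.2 0 * J.2 0 0 0 + J.1.1.2 0 ^ 2 * W.2 0 0 0
            + W.1.1.2 0 * J.1.2 0 0 ^ 2 + 2 * J.1.1.2 0 * J.1.2 0 0 * W.1.2 0 0
            - 2 * J.1.1.2 0 * W.1.1.2 0 + 4 * W.1.1.1 2 * J.1.1.2 0
            + 4 * J.1.1.1 2 * W.1.1.2 0) * J.1.2 1 0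
          - (J.1.1.2 0 ^ 2 * J.2 0 0 0 + J.1.1.2 0 * J.1.2 0 0 ^ 2 - J.1.1.2 0 ^ 2
            + 4 * J.1.1.1 2 * J.1.1.2 0) * W.1.2 1 0
          + W.1.1.2 0 * J.1.2 0 0 * J.1.1.2 1 + J.1.1.2 0 * W.1.2 0 0 * J.1.1.2 1
          + J.1.1.2 0 * J.1.2 0 0 * W.1.1.2 1,
        W.1.2 0 2, W.2 0 0 2, W.2 0 1 2, W.2 0 2 2] ν := by
  have hM2 : J.1.1.2 0 ^ 2 ≠ 0 := pow_ne_zero 2 hM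
  have hM0 : J.1.1.2 0 + 0 * W.1.1.2 0 ≠ 0 := by simpa using hM
  have hl := hasDerivAt_add_mul (J.1.1.1 2) (W.1.1.1 2)
  have hm := hasDerivAt_add_mul (J.1.1.2 0) (W.1.1.2 0)
  have hp := hasDerivAt_add_mul (J.1.1.2 1) (W.1.1.2 1)
  have hmy := hasDerivAt_add_mul (J.1.2 0 0) (W.1.2 0 0)
  have hpy := hasDerivAt_add_mul (J.1.2 1 0) (W.1.2 1 0)
  have hpt := hasDerivAt_add_mul (J.1.2 1 1) (W.1.2 1 1)
  have hmyy := hasDerivAt_add_mul (J.2 0 0 0) (W.2 0 0 0)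
  have hpyy := hasDerivAt_add_mul (J.2 1 0 0) (W.2 1 0 0)
  fin_cases ν
  · refine fderiv_eq_of_hasDerivAt_line
      (by simp only [rkdvLax, Fin.zero_eta, Matrix.cons_val_zero]
          fun_prop (disch := assumption)) ?_
    refine (hpyy.fun_sub (((hmy.fun_div hm hM0).fun_neg.fun_mul hpy).fun_add
      ((((hasDerivAt_const (0 : 𝕜) (1 : 𝕜)).fun_div hm hM0).fun_sub
        (hl.fun_div (hm.fun_pow 2) (pow_ne_zero 2 hM0))).fun_mul hp))).congr_deriv ?_
    simp
    field_simp
    ring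
  · refine fderiv_eq_of_hasDerivAt_line
      (by simp only [rkdvLax, Fin.mk_one, Matrix.cons_val_one, Matrix.cons_val_zero]; fun_prop) ?_
    refine (hpt.fun_sub ((((((hm.fun_pow 2).fun_mul hmyy).fun_add (hm.fun_mul
      (hmy.fun_pow 2))).fun_sub (hm.fun_pow 2)).fun_add
      (((hasDerivAt_const (0 : 𝕜) (4 : 𝕜)).fun_mul hl).fun_mul hm)).fun_mul hpy |>.fun_sub
      ((hm.fun_mul hmy).fun_mul hp))).congr_deriv ?_
    simp
    ring
  · exact fderiv_eq_of_hasDerivAt_line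
      (by change DifferentiableAt 𝕜 (fun J : Jet2 𝕜 3 2 => J.1.2 0 2) J; fun_prop)
      (hasDerivAt_add_mul _ _)
  · exact fderiv_eq_of_hasDerivAt_line
      (by change DifferentiableAt 𝕜 (fun J : Jet2 𝕜 3 2 => J.2 0 0 2) J; fun_prop)
      (hasDerivAt_add_mul _ _)
  · exact fderiv_eq_of_hasDerivAt_line
      (by change DifferentiableAt 𝕜 (fun J : Jet2 𝕜 3 2 => J.2 0 1 2) J; fun_prop)
      (hasDerivAt_add_mul _ _)
  · exact fderiv_eq_of_hasDerivAt_line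
      (by change DifferentiableAt 𝕜 (fun J : Jet2 𝕜 3 2 => J.2 0 2 2) J; fun_prop)
      (hasDerivAt_add_mul _ _)

end Linearization

section Linearization

variable {𝕜 : Type*} [RCLike 𝕜]

lemma fderiv_rmkdvLax {J : Jet2 𝕜 3 3} (hU : J.1.1.2 0 ≠ 0) (W : Jet2 𝕜 3 3) (ν : Fin 8) :
    fderiv 𝕜 (rmkdvLax ν) J W =
      ![W.1.2 1 0 + W.1.1.2 1 - J.1.1.1 2 * (J.1.1.2 0)⁻¹ * W.1.1.2 2
          - (W.1.1.1 2 * (J.1.1.2 0)⁻¹ - J.1.1.1 2 * W.1.1.2 0 * (J.1.1.2 0)⁻¹ ^ 2) * J.1.1.2 2,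
        W.1.2 2 0 - W.1.1.2 2 - J.1.1.1 2 * (J.1.1.2 0)⁻¹ * W.1.1.2 1
          - (W.1.1.1 2 * (J.1.1.2 0)⁻¹ - J.1.1.1 2 * W.1.1.2 0 * (J.1.1.2 0)⁻¹ ^ 2) * J.1.1.2 1,
        W.1.2 1 1
          - W.1.1.1 2 * (8 * J.1.1.1 2 * J.1.1.2 0 * J.1.1.2 1
            + (J.1.1.2 0 * J.2 0 0 0 + J.1.2 0 0 ^ 2 - 2 * J.1.1.2 0 * J.1.2 0 0
              - 12 * J.1.1.1 2 ^ 2) * J.1.1.2 2)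
          - J.1.1.1 2 * (4 * J.1.1.1 2 * W.1.1.2 0 * J.1.1.2 1
            + 4 * J.1.1.1 2 * J.1.1.2 0 * W.1.1.2 1
            + (W.1.1.2 0 * J.2 0 0 0 + J.1.1.2 0 * W.2 0 0 0
              + 2 * J.1.2 0 0 * W.1.2 0 0 - 2 * W.1.1.2 0 * J.1.2 0 0
              - 2 * J.1.1.2 0 * W.1.2 0 0) * J.1.1.2 2
            + (J.1.1.2 0 * J.2 0 0 0 + J.1.2 0 0 ^ 2 - 2 * J.1.1.2 0 * J.1.2 0 0
              - 4 * J.1.1.1 2 ^ 2) * W.1.1.2 2),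
        W.1.2 2 1
          - W.1.1.1 2 * ((J.1.1.2 0 * J.2 0 0 0 + J.1.2 0 0 ^ 2 + 2 * J.1.1.2 0 * J.1.2 0 0
              - 12 * J.1.1.1 2 ^ 2) * J.1.1.2 1 - 8 * J.1.1.1 2 * J.1.1.2 0 * J.1.1.2 2)
          - J.1.1.1 2 * ((W.1.1.2 0 * J.2 0 0 0 + J.1.1.2 0 * W.2 0 0 0
              + 2 * J.1.2 0 0 * W.1.2 0 0 + 2 * W.1.1.2 0 * J.1.2 0 0
              + 2 * J.1.1.2 0 * W.1.2 0 0) * J.1.1.2 1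
            + (J.1.1.2 0 * J.2 0 0 0 + J.1.2 0 0 ^ 2 + 2 * J.1.1.2 0 * J.1.2 0 0
              - 4 * J.1.1.1 2 ^ 2) * W.1.1.2 1
            - 4 * J.1.1.1 2 * W.1.1.2 0 * J.1.1.2 2 - 4 * J.1.1.1 2 * J.1.1.2 0 * W.1.1.2 2),
        W.1.2 0 2, W.2 0 0 2, W.2 0 1 2, W.2 0 2 2] ν := by
  have hU0 : J.1.1.2 0 + 0 * W.1.1.2 0 ≠ 0 := by simpa using hU
  have hl := hasDerivAt_add_mul (J.1.1.1 2) (W.1.1.1 2)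
  have hu := hasDerivAt_add_mul (J.1.1.2 0) (W.1.1.2 0)
  have hp := hasDerivAt_add_mul (J.1.1.2 1) (W.1.1.2 1)
  have hq := hasDerivAt_add_mul (J.1.1.2 2) (W.1.1.2 2)
  have huz := hasDerivAt_add_mul (J.1.2 0 0) (W.1.2 0 0)
  have huzz := hasDerivAt_add_mul (J.2 0 0 0) (W.2 0 0 0)
  have c2 := hasDerivAt_const (0 : 𝕜) (2 : 𝕜)
  have c4 := hasDerivAt_const (0 : 𝕜) (4 : 𝕜)
  have hlu := (c4.fun_mul hl).fun_mul hu
  have hs := (hu.fun_mul huzz).fun_add (huz.fun_pow 2)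
  have hd := (c2.fun_mul hu).fun_mul huz
  have hll := c4.fun_mul (hl.fun_pow 2)
  fin_cases ν
  · refine fderiv_eq_of_hasDerivAt_line
      (by simp only [rmkdvLax, Fin.zero_eta, Matrix.cons_val_zero]
          fun_prop (disch := assumption)) ?_
    refine ((hasDerivAt_add_mul (J.1.2 1 0) (W.1.2 1 0)).fun_sub
      (hp.fun_neg.fun_add ((hl.fun_div hu hU0).fun_mul hq))).congr_deriv ?_
    simp
    field_simp
    ring
  · refine fderiv_eq_of_hasDerivAt_line
      (by simp only [rmkdvLax, Fin.mk_one, Matrix.cons_val_one, Matrix.cons_val_zero]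
          fun_prop (disch := assumption)) ?_
    refine ((hasDerivAt_add_mul (J.1.2 2 0) (W.1.2 2 0)).fun_sub
      (((hl.fun_div hu hU0).fun_mul hp).fun_add hq)).congr_deriv ?_
    simp
    field_simp
    ring
  · refine fderiv_eq_of_hasDerivAt_line
      (by simp only [rmkdvLax, Fin.reduceFinMk, Matrix.cons_val]; fun_prop) ?_
    refine ((hasDerivAt_add_mul (J.1.2 1 1) (W.1.2 1 1)).fun_sub (hl.fun_mul
      ((hlu.fun_mul hp).fun_add (((hs.fun_sub hd).fun_sub hll).fun_mul hq)))).congr_deriv ?_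
    simp
    ring
  · refine fderiv_eq_of_hasDerivAt_line
      (by simp only [rmkdvLax, Fin.reduceFinMk, Matrix.cons_val]; fun_prop) ?_
    refine ((hasDerivAt_add_mul (J.1.2 2 1) (W.1.2 2 1)).fun_sub (hl.fun_mul
      ((((hs.fun_add hd).fun_sub hll).fun_mul hp).fun_sub (hlu.fun_mul hq)))).congr_deriv ?_
    simp
    ring
  · exact fderiv_eq_of_hasDerivAt_line
      (by change DifferentiableAt 𝕜 (fun J : Jet2 𝕜 3 3 => J.1.2 0 2) J; fun_prop)
      (hasDerivAt_add_mul _ _)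
  · exact fderiv_eq_of_hasDerivAt_line
      (by change DifferentiableAt 𝕜 (fun J : Jet2 𝕜 3 3 => J.2 0 0 2) J; fun_prop)
      (hasDerivAt_add_mul _ _)
  · exact fderiv_eq_of_hasDerivAt_line
      (by change DifferentiableAt 𝕜 (fun J : Jet2 𝕜 3 3 => J.2 0 1 2) J; fun_prop)
      (hasDerivAt_add_mul _ _)
  · exact fderiv_eq_of_hasDerivAt_line
      (by change DifferentiableAt 𝕜 (fun J : Jet2 𝕜 3 3 => J.2 0 2 2) J; fun_prop)
      (hasDerivAt_add_mul _ _)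

end Linearization

/-! ### Coordinate functions as ring elements -/

section Coordinates

variable {𝕜 : Type*} [RCLike 𝕜] {n m : ℕ}

/-- The coordinate function `x^i` on `Ω`. -/
def xCoord (Ω : Set (TotalSpace 𝕜 n m)) (i : Fin n) : smoothRing 𝕜 Ω :=
  toSmooth (fun p => p.1 i) (((contDiff_apply 𝕜 𝕜 i).comp contDiff_fst).contDiffOn)

/-- The coordinate function `u^α` on `Ω`. -/
def uCoord (Ω : Set (TotalSpace 𝕜 n m)) (α : Fin m) : smoothRing 𝕜 Ω :=
  toSmooth (fun p => p.2 α) (((contDiff_apply 𝕜 𝕜 α).comp contDiff_snd).contDiffOn)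

/-- The inverse of the coordinate function `u^α` on a set where it does not vanish. -/
def uCoordInv {Ω : Set (TotalSpace 𝕜 n m)} {α : Fin m} (h : ∀ p ∈ Ω, p.2 α ≠ 0) :
    smoothRing 𝕜 Ω :=
  toSmooth (fun p => (p.2 α)⁻¹)
    (((contDiff_apply 𝕜 𝕜 α).comp contDiff_snd).contDiffOn.inv h)

lemma uCoord_mul_inv {Ω : Set (TotalSpace 𝕜 n m)} {α : Fin m} (h : ∀ p ∈ Ω, p.2 α ≠ 0) :
    uCoord Ω α * uCoordInv h = 1 :=
  smoothRing_ext fun p => mul_inv_cancel₀ (h p p.2)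

@[simp] lemma smoothEval_algebraMap {E : Type*} [NormedAddCommGroup E] [NormedSpace 𝕜 E] {Ω : Set E}
    (p : Ω) (c : 𝕜) : smoothEval p (algebraMap 𝕜 (smoothRing 𝕜 Ω) c) = c := rfl

lemma smoothEval_ofNat {E : Type*} [NormedAddCommGroup E] [NormedSpace 𝕜 E] {Ω : Set E}
    (p : Ω) (k : ℕ) [k.AtLeastTwo] : smoothEval p (ofNat(k) : smoothRing 𝕜 Ω) = ofNat(k) :=
  map_ofNat (smoothEval p) k

@[simp] lemma smoothEval_xCoord {Ω : Set (TotalSpace 𝕜 n m)} (p : Ω) (i : Fin n) :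
    smoothEval p (xCoord Ω i) = p.1.1 i := rfl

@[simp] lemma smoothEval_uCoord {Ω : Set (TotalSpace 𝕜 n m)} (p : Ω) (α : Fin m) :
    smoothEval p (uCoord Ω α) = p.1.2 α := rfl

@[simp] lemma smoothEval_uCoordInv {Ω : Set (TotalSpace 𝕜 n m)} (p : Ω) {α : Fin m}
    (h : ∀ p ∈ Ω, p.2 α ≠ 0) : smoothEval p (uCoordInv h) = (p.1.2 α)⁻¹ := rfl

lemma smoothEval_ext {E : Type*} [NormedAddCommGroup E] [NormedSpace 𝕜 E] {Ω : Set E}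
    {F G : smoothRing 𝕜 Ω} (h : ∀ p, smoothEval p F = smoothEval p G) : F = G :=
  smoothRing_ext h

variable {Ω : Set (TotalSpace 𝕜 n m)} (hΩ : IsOpen Ω)

lemma pdiff_xCoord (v : TotalSpace 𝕜 n m) (i : Fin n) :
    pdiff 𝕜 hΩ v (xCoord Ω i) = algebraMap 𝕜 _ (v.1 i) :=
  smoothEval_ext fun p => by
    rw [xCoord, smoothEval_pdiff, smoothEval_algebraMap]
    refine fderiv_eq_of_hasDerivAt_line (by fun_prop) ?_
    exact hasDerivAt_add_mul _ _

lemma pdiff_uCoord (v : TotalSpace 𝕜 n m) (α : Fin m) :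
    pdiff 𝕜 hΩ v (uCoord Ω α) = algebraMap 𝕜 _ (v.2 α) :=
  smoothEval_ext fun p => by
    rw [uCoord, smoothEval_pdiff, smoothEval_algebraMap]
    refine fderiv_eq_of_hasDerivAt_line (by fun_prop) ?_
    exact hasDerivAt_add_mul _ _

lemma xDer_xCoord (i j : Fin n) : xDer hΩ i (xCoord Ω j) = if i = j then 1 else 0 := by
  rw [pdiff_xCoord]
  by_cases h : i = j
  · simp [xVec, h]
  · simp [xVec, h, Ne.symm h]

lemma uDer_uCoord (α β : Fin m) : uDer hΩ α (uCoord Ω β) = if α = β then 1 else 0 := by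
  rw [pdiff_uCoord]
  by_cases h : α = β
  · simp [uVec, h]
  · simp [uVec, h, Ne.symm h]

lemma xDer_uCoord (i : Fin n) (α : Fin m) : xDer hΩ i (uCoord Ω α) = 0 := by
  rw [pdiff_uCoord]
  simp [xVec]

lemma uDer_xCoord (α : Fin m) (i : Fin n) : uDer hΩ α (xCoord Ω i) = 0 := by
  rw [pdiff_xCoord]
  simp [uVec]

@[simp] lemma smoothEval_xCoeff {X : TotalSpace 𝕜 n m → TotalSpace 𝕜 n m}
    (hX : ContDiffOn 𝕜 ∞ X Ω) (p : Ω) (i : Fin n) : smoothEval p (xCoeff hX i) = (X p).1 i := rfl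

@[simp] lemma smoothEval_uCoeff {X : TotalSpace 𝕜 n m → TotalSpace 𝕜 n m}
    (hX : ContDiffOn 𝕜 ∞ X Ω) (p : Ω) (α : Fin m) : smoothEval p (uCoeff hX α) = (X p).2 α := rfl

end Coordinates

/-! ### Lie's criterion as determining equations over the smooth functions -/

section Symmetry

variable {𝕜 : Type*} [RCLike 𝕜]

-- From left to right, a family of solution jets with smooth entries is evaluated at each point.
-- From right to left, a single solution jet over p has to be extended to such a family on all of Ω.
set_option maxHeartbeats 1000000 in
theorem isLiePointSymmetry_rkdvLax_iff {Ω : Set (TotalSpace 𝕜 3 2)} (hΩ : IsOpen Ω)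
    (hM : ∀ p ∈ Ω, p.2 0 ≠ 0) {X : TotalSpace 𝕜 3 2 → TotalSpace 𝕜 3 2}
    (hX : ContDiffOn 𝕜 ∞ X Ω) :
    IsLiePointSymmetry rkdvLax Ω X ↔
      RkdvDetermining (xDer hΩ) (uDer hΩ) (xCoord Ω 2) (uCoord Ω 0) (uCoordInv hM) (uCoord Ω 1)
        (xCoeff hX) (uCoeff hX) := by
  constructor
  · intro h q r hr e1 e2 e3 e4 e5 e6
    have key : ∀ p : Ω, ∀ ν, _ := fun p ν => by
      have := h (smoothJet p q r) (fun α i j => by simp [smoothJet, hr α i j]) p.2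
        (by
          have f1 := congrArg (smoothEval p) e1
          have f2 := congrArg (smoothEval p) e2
          have f3 := congrArg (smoothEval p) e3
          have f4 := congrArg (smoothEval p) e4
          have f5 := congrArg (smoothEval p) e5
          have f6 := congrArg (smoothEval p) e6
          simp [smoothEval_ofNat] at f1 f2 f3 f4 f5 f6
          intro ν
          fin_cases ν
          · simp [rkdvLax, smoothJet, f1]
            ring
          · simp [rkdvLax, smoothJet, f2]
          all_goals simpa [rkdvLax, smoothJet]) ν
      rwa [fderiv_rkdvLax (hM p p.2)] at this
    refine ⟨?_, ?_, ?_, ?_, ?_, ?_⟩ <;> refine smoothEval_ext fun p => ?_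
    · simpa [prolongation, smoothEval_ringProlong₁, smoothEval_ringProlong₂, smoothEval_ofNat,
        smoothJet] using key p 0
    · simpa [prolongation, smoothEval_ringProlong₁, smoothEval_ringProlong₂, smoothEval_ofNat,
        smoothJet] using key p 1
    · simpa [prolongation, smoothEval_ringProlong₁, smoothJet] using key p 2
    · simpa [prolongation, smoothEval_ringProlong₂, smoothJet] using key p 3
    · simpa [prolongation, smoothEval_ringProlong₂, smoothJet] using key p 4
    · simpa [prolongation, smoothEval_ringProlong₂, smoothJet] using key p 5
  · intro h J hJ hp hΔ ν
    obtain ⟨⟨p, q₀⟩, r₀⟩ := J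
    let M := uCoord Ω 0
    let Mi := uCoordInv hM
    -- The extension of the jet: free coordinates are frozen at their values over p, while Φ_yy and
    -- Φ_T are defined by the Lax pair at every point of Ω.
    let r : Fin 2 → Fin 3 → Fin 3 → smoothRing 𝕜 Ω := fun α i j =>
      if α = 1 ∧ i = 0 ∧ j = 0 then
        -(algebraMap 𝕜 _ (q₀ 0 0) * Mi) * algebraMap 𝕜 _ (q₀ 1 0)
          + (Mi - xCoord Ω 2 * Mi ^ 2) * uCoord Ω 1
      else algebraMap 𝕜 _ (r₀ α i j)
    let q : Fin 2 → Fin 3 → smoothRing 𝕜 Ω := fun α i =>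
      if α = 1 ∧ i = 1 then
        (M ^ 2 * algebraMap 𝕜 _ (r₀ 0 0 0) + M * algebraMap 𝕜 _ (q₀ 0 0) ^ 2 - M ^ 2
          + 4 * xCoord Ω 2 * M) * algebraMap 𝕜 _ (q₀ 1 0)
          - M * algebraMap 𝕜 _ (q₀ 0 0) * uCoord Ω 1
      else algebraMap 𝕜 _ (q₀ α i)
    have d0 := hΔ 0
    have d1 := hΔ 1
    have d2 : q₀ 0 2 = 0 := hΔ 2
    have d3 : r₀ 0 0 2 = 0 := hΔ 3
    have d4 : r₀ 0 1 2 = 0 := hΔ 4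
    have d5 : r₀ 0 2 2 = 0 := hΔ 5
    simp [rkdvLax, sub_eq_zero] at d0 d1
    have hJet : smoothJet ⟨p, hp⟩ q r = ((p, q₀), r₀) := by
      refine Prod.ext (Prod.ext rfl ?_) ?_
      · funext α i
        by_cases hc : α = 1 ∧ i = 1
        · obtain ⟨rfl, rfl⟩ := hc
          simp [smoothJet, q, M, smoothEval_ofNat, d1]
        · simp [smoothJet, q, hc]
      · funext α i j
        by_cases hc : α = 1 ∧ i = 0 ∧ j = 0
        · obtain ⟨rfl, rfl, rfl⟩ := hc
          simp [smoothJet, r, Mi, d0]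
          ring
        · simp [smoothJet, r, hc]
    obtain ⟨k1, k2, k3, k4, k5, k6⟩ := h q r
      (by
        intro α i j
        have := hJ α i j
        simp only at this
        simp [r, this, and_comm (a := i = 0)])
      (by simp [q, r, Mi]) (by simp [q, r, M]) (by simp [q, d2]) (by simp [r, d3])
      (by simp [r, d4]) (by simp [r, d5])
    rw [← hJet, fderiv_rkdvLax (hM p hp)]
    have f1 := congrArg (smoothEval ⟨p, hp⟩) k1
    have f2 := congrArg (smoothEval ⟨p, hp⟩) k2
    have f3 := congrArg (smoothEval ⟨p, hp⟩) k3
    have f4 := congrArg (smoothEval ⟨p, hp⟩) k4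
    have f5 := congrArg (smoothEval ⟨p, hp⟩) k5
    have f6 := congrArg (smoothEval ⟨p, hp⟩) k6
    clear_value q r
    simp [smoothEval_ringProlong₁, smoothEval_ringProlong₂, smoothEval_ofNat] at f1 f2 f3 f4 f5 f6
    fin_cases ν
    · simpa [prolongation, smoothJet] using f1
    · simpa [prolongation, smoothJet] using f2
    · simpa [prolongation, smoothJet] using f3
    · simpa [prolongation, smoothJet] using f4
    · simpa [prolongation, smoothJet] using f5
    · simpa [prolongation, smoothJet] using f6

end Symmetry

section Symmetry

variable {𝕜 : Type*} [RCLike 𝕜]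

set_option maxHeartbeats 1000000 in
theorem isLiePointSymmetry_rmkdvLax_iff {Ω : Set (TotalSpace 𝕜 3 3)} (hΩ : IsOpen Ω)
    (hU : ∀ p ∈ Ω, p.2 0 ≠ 0) {X : TotalSpace 𝕜 3 3 → TotalSpace 𝕜 3 3}
    (hX : ContDiffOn 𝕜 ∞ X Ω) :
    IsLiePointSymmetry rmkdvLax Ω X ↔
      RmkdvDetermining (xDer hΩ) (uDer hΩ) (xCoord Ω 2) (uCoord Ω 0) (uCoordInv hU) (uCoord Ω 1)
        (uCoord Ω 2) (xCoeff hX) (uCoeff hX) := by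
  constructor
  · intro h q r hr e1 e2 e3 e4 e5 e6 e7 e8
    have key : ∀ p : Ω, ∀ ν, _ := fun p ν => by
      have := h (smoothJet p q r) (fun α i j => by simp [smoothJet, hr α i j]) p.2
        (by
          have f1 := congrArg (smoothEval p) e1
          have f2 := congrArg (smoothEval p) e2
          have f3 := congrArg (smoothEval p) e3
          have f4 := congrArg (smoothEval p) e4
          have f5 := congrArg (smoothEval p) e5
          have f6 := congrArg (smoothEval p) e6
          have f7 := congrArg (smoothEval p) e7
          have f8 := congrArg (smoothEval p) e8
          simp [smoothEval_ofNat] at f1 f2 f3 f4 f5 f6 f7 f8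
          intro ν
          fin_cases ν
          · simp [rmkdvLax, smoothJet, f1, div_eq_mul_inv]
          · simp [rmkdvLax, smoothJet, f2, div_eq_mul_inv]
          · simp [rmkdvLax, smoothJet, f3]
          · simp [rmkdvLax, smoothJet, f4]
          all_goals simpa [rmkdvLax, smoothJet]) ν
      rwa [fderiv_rmkdvLax (hU p p.2)] at this
    refine ⟨?_, ?_, ?_, ?_, ?_, ?_, ?_, ?_⟩ <;> refine smoothEval_ext fun p => ?_
    · simpa [prolongation, smoothEval_ringProlong₁, smoothJet] using key p 0
    · simpa [prolongation, smoothEval_ringProlong₁, smoothJet] using key p 1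
    · simpa [prolongation, smoothEval_ringProlong₁, smoothEval_ringProlong₂, smoothEval_ofNat,
        smoothJet] using key p 2
    · simpa [prolongation, smoothEval_ringProlong₁, smoothEval_ringProlong₂, smoothEval_ofNat,
        smoothJet] using key p 3
    · simpa [prolongation, smoothEval_ringProlong₁, smoothJet] using key p 4
    · simpa [prolongation, smoothEval_ringProlong₂, smoothJet] using key p 5
    · simpa [prolongation, smoothEval_ringProlong₂, smoothJet] using key p 6
    · simpa [prolongation, smoothEval_ringProlong₂, smoothJet] using key p 7
  · intro h J hJ hp hΔ ν
    obtain ⟨⟨p, q₀⟩, r₀⟩ := J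
    let l := xCoord Ω 2
    let U := uCoord Ω 0
    let P := uCoord Ω 1
    let Q := uCoord Ω 2
    let Ui := uCoordInv hU
    let a : smoothRing 𝕜 Ω := algebraMap 𝕜 _ (q₀ 0 0)
    let b : smoothRing 𝕜 Ω := algebraMap 𝕜 _ (r₀ 0 0 0)
    -- This Lax pair is of first order in Ψ, so all second jets can be frozen; only the z- and
    -- τ-derivatives of Ψ must vary with the point.
    let r : Fin 3 → Fin 3 → Fin 3 → smoothRing 𝕜 Ω := fun α i j => algebraMap 𝕜 _ (r₀ α i j)
    let q : Fin 3 → Fin 3 → smoothRing 𝕜 Ω :=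
      ![![a, algebraMap 𝕜 _ (q₀ 0 1), 0],
        ![-P + l * Ui * Q, l * (4 * l * U * P + (U * b + a ^ 2 - 2 * U * a - 4 * l ^ 2) * Q),
          algebraMap 𝕜 _ (q₀ 1 2)],
        ![l * Ui * P + Q, l * ((U * b + a ^ 2 + 2 * U * a - 4 * l ^ 2) * P - 4 * l * U * Q),
          algebraMap 𝕜 _ (q₀ 2 2)]]
    have d0 := hΔ 0
    have d1 := hΔ 1
    have d2 := hΔ 2
    have d3 := hΔ 3
    have d4 : q₀ 0 2 = 0 := hΔ 4
    have d5 : r₀ 0 0 2 = 0 := hΔ 5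
    have d6 : r₀ 0 1 2 = 0 := hΔ 6
    have d7 : r₀ 0 2 2 = 0 := hΔ 7
    simp [rmkdvLax, sub_eq_zero, div_eq_mul_inv] at d0 d1 d2 d3
    have hJet : smoothJet ⟨p, hp⟩ q r = ((p, q₀), r₀) := by
      refine Prod.ext (Prod.ext rfl ?_) rfl
      funext α i
      fin_cases α <;> fin_cases i <;>
        simp [smoothJet, q, l, U, P, Q, Ui, a, b, smoothEval_ofNat, d0, d1, d2, d3, d4]
    obtain ⟨k1, k2, k3, k4, k5, k6, k7, k8⟩ := h q r
      (by
        intro α i j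
        have := hJ α i j
        simp only at this
        simp [r, this])
      rfl rfl rfl rfl rfl (by simp [r, d5]) (by simp [r, d6]) (by simp [r, d7])
    rw [← hJet, fderiv_rmkdvLax (hU p hp)]
    clear_value q r
    fin_cases ν
    · have := congrArg (smoothEval ⟨p, hp⟩) k1
      simpa [prolongation, smoothEval_ringProlong₁, smoothJet] using this
    · have := congrArg (smoothEval ⟨p, hp⟩) k2
      simpa [prolongation, smoothEval_ringProlong₁, smoothJet] using this
    · have := congrArg (smoothEval ⟨p, hp⟩) k3
      simpa [prolongation, smoothEval_ringProlong₁, smoothEval_ringProlong₂, smoothEval_ofNat,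
        smoothJet] using this
    · have := congrArg (smoothEval ⟨p, hp⟩) k4
      simpa [prolongation, smoothEval_ringProlong₁, smoothEval_ringProlong₂, smoothEval_ofNat,
        smoothJet] using this
    · have := congrArg (smoothEval ⟨p, hp⟩) k5
      simpa [prolongation, smoothEval_ringProlong₁, smoothJet] using this
    · have := congrArg (smoothEval ⟨p, hp⟩) k6
      simpa [prolongation, smoothEval_ringProlong₂, smoothJet] using this
    · have := congrArg (smoothEval ⟨p, hp⟩) k7
      simpa [prolongation, smoothEval_ringProlong₂, smoothJet] using this
    · have := congrArg (smoothEval ⟨p, hp⟩) k8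
      simpa [prolongation, smoothEval_ringProlong₂, smoothJet] using this

end Symmetry

/-! ### From vanishing derivatives to constants and functions of the spectral parameter -/

section Domains

variable {𝕜 : Type*} [RCLike 𝕜] {n m : ℕ}

lemma fderiv_extendZero {Ω : Set (TotalSpace 𝕜 n m)} (hΩ : IsOpen Ω) (F : smoothRing 𝕜 Ω) (p : Ω)
    (v : TotalSpace 𝕜 n m) :
    fderiv 𝕜 (extendZero F.1) p v = ∑ i, v.1 i * smoothEval p (xDer hΩ i F)
      + ∑ α, v.2 α * smoothEval p (uDer hΩ α F) := by
  conv_lhs => rw [← Prod.mk.eta (p := v), totalSpace_eq_sum]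
  simp only [map_add, map_sum, map_smul, smul_eq_mul]
  rfl

lemma exists_eq_algebraMap {Ω : Set (TotalSpace 𝕜 n m)} (hΩ : IsOpen Ω) (hc : IsPreconnected Ω)
    {F : smoothRing 𝕜 Ω} (hx : ∀ i, xDer hΩ i F = 0) (hu : ∀ α, uDer hΩ α F = 0) :
    ∃ c : 𝕜, F = algebraMap 𝕜 _ c := by
  obtain ⟨c, h⟩ := hΩ.exists_is_const_of_fderiv_eq_zero hc
    (fun p hp => (smoothRing_differentiableAt hΩ F ⟨p, hp⟩).differentiableWithinAt)
    (fun p hp => by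
      refine ContinuousLinearMap.ext fun v => ?_
      rw [fderiv_extendZero hΩ F ⟨p, hp⟩]
      simp [hx, hu])
  exact ⟨c, smoothRing_ext fun p => by rw [← extendZero_apply F.1 p.2, h p p.2]; rfl⟩

lemma isOpen_spectralValues {Ω : Set (TotalSpace 𝕜 3 m)} (hΩ : IsOpen Ω) :
    IsOpen (spectralValues Ω) :=
  ((isOpenMap_eval (2 : Fin 3)).comp isOpenMap_fst) Ω hΩ

/-- The smooth function `f(x^2)` on `Ω`. -/
def spectralFun {Ω : Set (TotalSpace 𝕜 3 m)} {f : 𝕜 → 𝕜}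
    (hf : ContDiffOn 𝕜 ∞ f (spectralValues Ω)) : smoothRing 𝕜 Ω :=
  toSmooth (fun p => f (p.1 2)) (hf.comp
    (((contDiff_apply 𝕜 𝕜 (2 : Fin 3)).comp contDiff_fst).contDiffOn) fun p hp => ⟨p, hp, rfl⟩)

@[simp] lemma smoothEval_spectralFun {Ω : Set (TotalSpace 𝕜 3 m)} {f : 𝕜 → 𝕜}
    (hf : ContDiffOn 𝕜 ∞ f (spectralValues Ω)) (p : Ω) :
    smoothEval p (spectralFun hf) = f (p.1.1 2) := rfl

lemma pdiff_spectralFun {Ω : Set (TotalSpace 𝕜 3 m)} (hΩ : IsOpen Ω) {f : 𝕜 → 𝕜}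
    (hf : ContDiffOn 𝕜 ∞ f (spectralValues Ω)) {v : TotalSpace 𝕜 3 m} (hv : v.1 2 = 0) :
    pdiff 𝕜 hΩ v (spectralFun hf) = 0 :=
  smoothEval_ext fun p => by
    rw [spectralFun, smoothEval_pdiff, map_zero]
    refine fderiv_eq_of_hasDerivAt_line ?_ ?_
    · exact DifferentiableAt.comp (p : TotalSpace 𝕜 3 m) (((hf.contDiffAt
        ((isOpen_spectralValues hΩ).mem_nhds ⟨p, p.2, rfl⟩)).differentiableAt (by simp)))
        (by fun_prop : DifferentiableAt 𝕜 (fun q : TotalSpace 𝕜 3 m => q.1 2) p)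
    · simpa [hv] using hasDerivAt_const (0 : 𝕜) (f (p.1.1 2))

/-- A smooth function whose derivatives transversal to `x^2` vanish is constant on the sections
`{x^2 = const}`, provided that these are connected. -/
lemma apply_eq_of_section {Ω : Set (TotalSpace 𝕜 3 m)} (hΩ : IsOpen Ω)
    (hs : ∀ c : 𝕜, IsPreconnected {p ∈ Ω | p.1 2 = c}) {F : smoothRing 𝕜 Ω}
    (h0 : xDer hΩ 0 F = 0) (h1 : xDer hΩ 1 F = 0) (hu : ∀ α, uDer hΩ α F = 0)
    {p q : TotalSpace 𝕜 3 m} (hp : p ∈ Ω) (hq : q ∈ Ω) (hpq : p.1 2 = q.1 2) :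
    extendZero F.1 p = extendZero F.1 q := by
  let S : Set (TotalSpace 𝕜 3 m) := {x ∈ Ω | x.1 2 = q.1 2}
  have : PreconnectedSpace S := isPreconnected_iff_preconnectedSpace.1 (hs _)
  have hloc : IsLocallyConstant (fun x : S => extendZero F.1 x) := by
    rw [IsLocallyConstant.iff_eventually_eq]
    rintro ⟨x, hx, hx2⟩
    obtain ⟨ε, hε, hball⟩ := Metric.isOpen_iff.1 hΩ x hx
    filter_upwards [continuous_subtype_val.continuousAt.preimage_mem_nhds
      (Metric.ball_mem_nhds x hε)]
    rintro ⟨y, hy, hy2⟩ hyx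
    change y ∈ Metric.ball x ε at hyx
    change extendZero F.1 y = extendZero F.1 x
    rcases eq_or_ne y x with rfl | hne
    · rfl
    have hpos : 0 < ‖y - x‖ := norm_pos_iff.2 (sub_ne_zero.2 hne)
    -- Two nearby points of a section are joined by the 𝕜-line through them, whose direction has no
    -- x^2 component. The radius exceeds 1, so both t = 0 and t = 1 lie in the parameter ball.
    have hmem : ∀ t ∈ Metric.ball (0 : 𝕜) (ε / ‖y - x‖), x + t • (y - x) ∈ Ω := fun t ht => by
      apply hball
      rw [mem_ball_zero_iff, lt_div_iff₀ hpos] at ht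
      rwa [mem_ball_iff_norm, add_sub_cancel_left, norm_smul]
    have hder : ∀ t ∈ Metric.ball (0 : 𝕜) (ε / ‖y - x‖),
        HasDerivAt (fun t : 𝕜 => extendZero F.1 (x + t • (y - x))) 0 t := fun t ht => by
      have hd := smoothRing_differentiableAt hΩ F ⟨_, hmem t ht⟩
      have hl : HasDerivAt (fun t : 𝕜 => x + t • (y - x)) (y - x) t := by
        simpa using ((hasDerivAt_id t).smul_const (y - x)).const_add x
      refine (hd.hasFDerivAt.comp_hasDerivAt t hl).congr_deriv ?_
      rw [fderiv_extendZero hΩ F ⟨_, hmem t ht⟩]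
      simp [Fin.sum_univ_three, h0, h1, hu, hy2, hx2]
    have := Metric.isOpen_ball.is_const_of_deriv_eq_zero
      (Metric.isPreconnected_ball (x := (0 : 𝕜)) (r := ε / ‖y - x‖))
      (fun t ht => (hder t ht).differentiableAt.differentiableWithinAt)
      (fun t ht => (hder t ht).deriv) (x := 1) (y := 0)
      (by
        rw [mem_ball_zero_iff, norm_one, one_lt_div hpos]
        rwa [mem_ball_iff_norm] at hyx)
      (by
        rw [mem_ball_zero_iff, norm_zero]
        exact div_pos hε hpos)
    simpa using this
  exact hloc.apply_eq_of_preconnectedSpace ⟨p, hp, hpq⟩ ⟨q, hq, rfl⟩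

/-- Constancy on sections makes f well defined by choosing any point of the section. Smoothness is
local: near the parameter value of p, f is F restricted to the line through p in the x^2 direction.
-/
lemma exists_eq_spectralFun {Ω : Set (TotalSpace 𝕜 3 m)} (hΩ : IsOpen Ω)
    (hs : ∀ c : 𝕜, IsPreconnected {p ∈ Ω | p.1 2 = c}) {F : smoothRing 𝕜 Ω}
    (h0 : xDer hΩ 0 F = 0) (h1 : xDer hΩ 1 F = 0) (hu : ∀ α, uDer hΩ α F = 0) :
    ∃ (f : 𝕜 → 𝕜) (hf : ContDiffOn 𝕜 ∞ f (spectralValues Ω)), F = spectralFun hf := by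
  classical
  let f : 𝕜 → 𝕜 := fun c => if h : c ∈ spectralValues Ω then extendZero F.1 h.choose else 0
  have hfF : ∀ p ∈ Ω, f (p.1 2) = extendZero F.1 p := fun p hp => by
    have h : p.1 2 ∈ spectralValues Ω := ⟨p, hp, rfl⟩
    simp only [f, dif_pos h]
    exact apply_eq_of_section hΩ hs h0 h1 hu h.choose_spec.1 hp h.choose_spec.2
  have hf : ContDiffOn 𝕜 ∞ f (spectralValues Ω) := by
    rintro _ ⟨p, hp, rfl⟩
    let φ : 𝕜 → TotalSpace 𝕜 3 m := fun t => p + (t - p.1 2) • xVec 𝕜 m 2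
    have hφ : ContDiff 𝕜 ∞ φ :=
      contDiff_const.add ((contDiff_id.sub contDiff_const).smul contDiff_const)
    have hφp : φ (p.1 2) = p := by simp [φ]
    have hφ2 : ∀ t, (φ t).1 2 = t := fun t => by simp [φ, xVec]
    refine ContDiffAt.contDiffWithinAt ?_
    have hc : ContDiffAt 𝕜 ∞ (fun t => extendZero F.1 (φ t)) (p.1 2) := by
      refine ContDiffAt.comp (p.1 2) ?_ hφ.contDiffAt
      rw [hφp]
      exact (smoothRing_contDiffOn F).contDiffAt (hΩ.mem_nhds hp)
    refine hc.congr_of_eventuallyEq ?_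
    have hn : φ ⁻¹' Ω ∈ nhds (p.1 2) :=
      hφ.continuous.continuousAt.preimage_mem_nhds (by rw [hφp]; exact hΩ.mem_nhds hp)
    filter_upwards [hn] with t ht
    rw [← hfF _ ht, hφ2]
  refine ⟨f, hf, smoothEval_ext fun p => ?_⟩
  rw [smoothEval_spectralFun, hfF p.1 p.2, extendZero_apply F.1 p.2]
  rfl

/-- In every open set containing `p` there are points near `p` with the same independent variables
and a nonvanishing dependent variable `u^α`. -/
lemma exists_mem_uCoord_ne_zero {Ω : Set (TotalSpace 𝕜 n m)} (hΩ : IsOpen Ω) (α : Fin m)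
    {p : TotalSpace 𝕜 n m} (hp : p ∈ Ω) : ∃ q ∈ Ω, q.1 = p.1 ∧ q.2 α ≠ 0 := by
  by_contra! h
  have h0 : p.2 α = 0 := h p hp rfl
  have hc : Continuous fun t : 𝕜 => p + t • uVec 𝕜 n α := by fun_prop
  have hn : (fun t : 𝕜 => p + t • uVec 𝕜 n α) ⁻¹' Ω ∈ nhds 0 :=
    hc.continuousAt.preimage_mem_nhds (by simpa using hΩ.mem_nhds hp)
  obtain ⟨t, ht, ht0⟩ := (mem_closure_iff_nhds.1
    (by simp : (0 : 𝕜) ∈ closure ({0}ᶜ : Set 𝕜))) _ hn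
  have := h _ ht (by simp [uVec])
  simp [uVec, h0] at this
  exact ht0 this

/-- An affine function of `x^i` vanishing on a nonempty open set is zero. -/
lemma eq_zero_of_mul_xCoord_add {Ω : Set (TotalSpace 𝕜 n m)} (hΩ : IsOpen Ω) (hne : Ω.Nonempty)
    {i : Fin n} {a b : 𝕜} (h : ∀ p ∈ Ω, a * p.1 i + b = 0) : a = 0 ∧ b = 0 := by
  obtain ⟨p, hp⟩ := hne
  have h1 : algebraMap 𝕜 (smoothRing 𝕜 Ω) a * xCoord Ω i + algebraMap 𝕜 _ b = 0 :=
    smoothEval_ext fun q => by simpa using h q q.2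
  have h2 := congrArg (xDer hΩ i) h1
  have h3 := congrArg (smoothEval ⟨p, hp⟩) h2
  simp [xDer_xCoord] at h3
  exact ⟨h3, by simpa [h3] using h p hp⟩

end Domains

/-! ### Classification, uniqueness of the coefficients, commutators -/

section Classification

variable {𝕜 : Type*} [RCLike 𝕜]

lemma uCoord_cancel {n m : ℕ} {Ω : Set (TotalSpace 𝕜 n m)} (hΩ : IsOpen Ω) (α : Fin m)
    (F : smoothRing 𝕜 Ω) (h : uCoord Ω α * F = 0) : F = 0 :=
  smoothRing_eq_zero_of_mul_eq_zero hΩ (v := uVec 𝕜 n α)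
    ((uDer_uCoord hΩ α α).trans (if_pos rfl)) h

lemma xCoord_cancel {n m : ℕ} {Ω : Set (TotalSpace 𝕜 n m)} (hΩ : IsOpen Ω) (i : Fin n)
    (F : smoothRing 𝕜 Ω) (h : xCoord Ω i * F = 0) : F = 0 :=
  smoothRing_eq_zero_of_mul_eq_zero hΩ (v := xVec 𝕜 m i)
    ((xDer_xCoord hΩ i i).trans (if_pos rfl)) h

set_option maxHeartbeats 1000000 in
theorem isLiePointSymmetry_rkdvLax {Ω : Set (TotalSpace 𝕜 3 2)} (hΩ : IsLaxDomain Ω 0)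
    {X : TotalSpace 𝕜 3 2 → TotalSpace 𝕜 3 2} (hX : ContDiffOn 𝕜 ∞ X Ω) :
    IsLiePointSymmetry rkdvLax Ω X ↔
      ∃ (C₁ C₂ C₃ : 𝕜) (f : 𝕜 → 𝕜), ContDiffOn 𝕜 ∞ f (spectralValues Ω) ∧
        ∀ p ∈ Ω, X p = C₁ • rkdvScaling p + C₂ • rkdvShiftY p + C₃ • rkdvShiftT p
          + f (p.1 2) • rkdvGauge p := by
  obtain ⟨ho, hc, hs, hM⟩ := hΩ
  rw [isLiePointSymmetry_rkdvLax_iff ho hM hX]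
  constructor
  · intro h
    obtain ⟨⟨b1, b2⟩, ⟨y1, y2, y3⟩, ⟨t0, t1, t2, t3⟩, hL, hN, hH, g0, g1, g2⟩ := rkdv_core
      (fun i j F => pdiff_comm ho _ _ F) (fun i j F => pdiff_comm ho _ _ F)
      (fun i j F => pdiff_comm ho _ _ F) (uCoord_mul_inv hM) (fun i => xDer_xCoord ho i 2)
      (fun α => uDer_xCoord ho α 2) (fun i => xDer_uCoord ho i 0) (fun α => uDer_uCoord ho α 0)
      (fun α => uDer_uCoord ho α 1) (xCoord_cancel ho 2) (uCoord_cancel ho 1)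
      (fun F hF => smoothRing_eq_zero_of_natCast_mul two_ne_zero (by exact_mod_cast hF)) h
    obtain ⟨C₁, hC₁⟩ := exists_eq_algebraMap ho hc.isPreconnected b1 b2
    rw [hC₁] at t1 hL hN
    -- C₁ is the constant Y_y. Removing the scaling part from Y, and below from T, leaves functions
    -- with zero gradient.
    obtain ⟨C₂, hC₂⟩ := exists_eq_algebraMap ho hc.isPreconnected
      (F := xCoeff hX 0 - algebraMap 𝕜 _ C₁ * xCoord Ω 0)
      (fun i => by
        fin_cases i
        · simp [xDer_xCoord, hC₁]
        · simp [xDer_xCoord, y1]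
        · simp [xDer_xCoord, y2])
      (fun α => by simp [uDer_xCoord, y3])
    obtain ⟨C₃, hC₃⟩ := exists_eq_algebraMap ho hc.isPreconnected
      (F := xCoeff hX 1 + 3 * algebraMap 𝕜 _ C₁ * xCoord Ω 1)
      (fun i => by
        fin_cases i
        · simp [xDer_xCoord, t0, Derivation.map_ofNat_eq_zero]
        · simp [xDer_xCoord, t1, Derivation.map_ofNat_eq_zero]
          ring
        · simp [xDer_xCoord, t2, Derivation.map_ofNat_eq_zero])
      (fun α => by simp [uDer_xCoord, t3, Derivation.map_ofNat_eq_zero])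
    obtain ⟨f, hf, hfF⟩ := exists_eq_spectralFun ho hs g0 g1 g2
    rw [hfF] at hH
    refine ⟨C₁, C₂, C₃, f, hf, fun p hp => ?_⟩
    have e0 := congrArg (smoothEval ⟨p, hp⟩) hC₂
    have e1 := congrArg (smoothEval ⟨p, hp⟩) hC₃
    have e2 := congrArg (smoothEval ⟨p, hp⟩) hL
    have e3 := congrArg (smoothEval ⟨p, hp⟩) hN
    have e4 := congrArg (smoothEval ⟨p, hp⟩) hH
    simp [smoothEval_ofNat] at e0 e1 e2 e3 e4
    refine Prod.ext ?_ ?_ <;> funext i <;> fin_cases i <;>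
      simp [rkdvScaling, rkdvShiftY, rkdvShiftT, rkdvGauge]
    · linear_combination e0
    · linear_combination e1
    · linear_combination e2
    · linear_combination e3
    · linear_combination e4
  · rintro ⟨C₁, C₂, C₃, f, hf, hXf⟩
    refine rkdvDetermining_of_eq (c := algebraMap 𝕜 _ C₁)
      (y := algebraMap 𝕜 _ C₁ * xCoord Ω 0 + algebraMap 𝕜 _ C₂)
      (T := -3 * algebraMap 𝕜 _ C₁ * xCoord Ω 1 + algebraMap 𝕜 _ C₃) (f := spectralFun hf)
      (uCoord_mul_inv hM) (fun i => xDer_xCoord ho i 2) (fun α => uDer_xCoord ho α 2)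
      (fun i => xDer_uCoord ho i 0) (fun α => uDer_uCoord ho α 0)
      (fun i => xDer_uCoord ho i 1) (fun α => uDer_uCoord ho α 1)
      (fun i => Derivation.map_algebraMap _ _) (fun α => Derivation.map_algebraMap _ _)
      (fun i => by simp [xDer_xCoord]) (fun α => by simp [uDer_xCoord])
      (fun i => by simp [xDer_xCoord, Derivation.map_ofNat_eq_zero])
      (fun α => by simp [uDer_xCoord, Derivation.map_ofNat_eq_zero])
      (pdiff_spectralFun ho hf (by simp [xVec])) (pdiff_spectralFun ho hf (by simp [xVec]))
      (fun α => pdiff_spectralFun ho hf (by simp [uVec])) ?_ ?_ <;> funext i <;>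
      refine smoothEval_ext fun p => ?_
    · rw [smoothEval_xCoeff, hXf p p.2]
      fin_cases i <;>
        simp [rkdvScaling, rkdvShiftY, rkdvShiftT, rkdvGauge, smoothEval_ofNat] <;> ring
    · rw [smoothEval_uCoeff, hXf p p.2]
      fin_cases i <;>
        simp [rkdvScaling, rkdvShiftY, rkdvShiftT, rkdvGauge, smoothEval_ofNat]
      ring

/-- The y- and T-components are affine functions of y and T vanishing on an open set, which kills
the constants. The Φ-component is then f(λ) Φ; since Φ may vanish at the given point, one moves to a
point with the same λ and Φ ≠ 0. -/
theorem rkdv_coefficients_unique {Ω : Set (TotalSpace 𝕜 3 2)} (hΩ : IsLaxDomain Ω 0)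
    {C₁ C₂ C₃ : 𝕜} {f : 𝕜 → 𝕜}
    (h : ∀ p ∈ Ω, C₁ • rkdvScaling p + C₂ • rkdvShiftY p + C₃ • rkdvShiftT p
      + f (p.1 2) • rkdvGauge p = 0) :
    C₁ = 0 ∧ C₂ = 0 ∧ C₃ = 0 ∧ ∀ c ∈ spectralValues Ω, f c = 0 := by
  obtain ⟨h1, h2⟩ := eq_zero_of_mul_xCoord_add hΩ.isOpen hΩ.isConnected.nonempty (i := 0)
    (a := C₁) (b := C₂) fun p hp => by
      simpa [rkdvScaling, rkdvShiftY, rkdvShiftT, rkdvGauge]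
        using congrArg (fun v => v.1 0) (h p hp)
  obtain ⟨-, h3⟩ := eq_zero_of_mul_xCoord_add hΩ.isOpen hΩ.isConnected.nonempty (i := 1)
    (a := -3 * C₁) (b := C₃) fun p hp => by
      have := congrArg (fun v => v.1 1) (h p hp)
      simp [rkdvScaling, rkdvShiftY, rkdvShiftT, rkdvGauge] at this
      linear_combination this
  refine ⟨h1, h2, h3, ?_⟩
  rintro _ ⟨p, hp, rfl⟩
  obtain ⟨q, hq, hqp, hne⟩ := exists_mem_uCoord_ne_zero hΩ.isOpen 1 hp
  have := congrArg (fun v => v.2 1) (h q hq)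
  simp [rkdvScaling, rkdvShiftY, rkdvShiftT, rkdvGauge, hqp, hne] at this
  exact this

set_option maxHeartbeats 1000000 in
theorem isLiePointSymmetry_rmkdvLax {Ω : Set (TotalSpace 𝕜 3 3)} (hΩ : IsLaxDomain Ω 0)
    {X : TotalSpace 𝕜 3 3 → TotalSpace 𝕜 3 3} (hX : ContDiffOn 𝕜 ∞ X Ω) :
    IsLiePointSymmetry rmkdvLax Ω X ↔
      ∃ (D₁ D₂ D₃ : 𝕜) (g : 𝕜 → 𝕜), ContDiffOn 𝕜 ∞ g (spectralValues Ω) ∧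
        ∀ p ∈ Ω, X p = D₁ • rmkdvScaling p + D₂ • rmkdvShiftZ p + D₃ • rmkdvShiftTau p
          + g (p.1 2) • rmkdvGauge p := by
  obtain ⟨ho, hc, hs, hU⟩ := hΩ
  rw [isLiePointSymmetry_rmkdvLax_iff ho hU hX]
  constructor
  · intro h
    obtain ⟨⟨b1, b2⟩, ⟨z1, z2⟩, ⟨t0, t1, t2, t3⟩, hL, hN, hH, hK, g0, g1, g2⟩ := rmkdv_core
      (fun i j F => pdiff_comm ho _ _ F) (fun i j F => pdiff_comm ho _ _ F)
      (fun i j F => pdiff_comm ho _ _ F) (uCoord_mul_inv hU) (fun i => xDer_xCoord ho i 2)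
      (fun α => uDer_xCoord ho α 2) (fun i => xDer_uCoord ho i 0) (fun α => uDer_uCoord ho α 0)
      (fun i => xDer_uCoord ho i 1) (fun α => uDer_uCoord ho α 1)
      (fun i => xDer_uCoord ho i 2) (fun α => uDer_uCoord ho α 2)
      (xCoord_cancel ho 2) (uCoord_cancel ho 1) (uCoord_cancel ho 2)
      (fun F hF => smoothRing_eq_zero_of_natCast_mul two_ne_zero (by exact_mod_cast hF))
      (fun F hF => smoothRing_eq_zero_of_natCast_mul three_ne_zero (by exact_mod_cast hF)) h
    obtain ⟨B, hB⟩ := exists_eq_algebraMap ho hc.isPreconnected b1 b2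
    rw [hB] at t1 hL hN
    obtain ⟨D₂, hD₂⟩ := exists_eq_algebraMap ho hc.isPreconnected z1 z2
    obtain ⟨D₃, hD₃⟩ := exists_eq_algebraMap ho hc.isPreconnected
      (F := xCoeff hX 1 + 3 * algebraMap 𝕜 _ B * xCoord Ω 1)
      (fun i => by
        fin_cases i
        · simp [xDer_xCoord, t0, Derivation.map_ofNat_eq_zero]
        · simp [xDer_xCoord, t1, Derivation.map_ofNat_eq_zero]
          ring
        · simp [xDer_xCoord, t2, Derivation.map_ofNat_eq_zero])
      (fun α => by simp [uDer_xCoord, t3, Derivation.map_ofNat_eq_zero])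
    obtain ⟨g, hg, hgF⟩ := exists_eq_spectralFun ho hs g0 g1 g2
    rw [hgF] at hH hK
    -- B is the constant N_U, whereas the scaling field contains -U ∂_U; hence the sign.
    refine ⟨-B, D₂, D₃, g, hg, fun p hp => ?_⟩
    have e0 := congrArg (smoothEval ⟨p, hp⟩) hD₂
    have e1 := congrArg (smoothEval ⟨p, hp⟩) hD₃
    have e2 := congrArg (smoothEval ⟨p, hp⟩) hL
    have e3 := congrArg (smoothEval ⟨p, hp⟩) hN
    have e4 := congrArg (smoothEval ⟨p, hp⟩) hH
    have e5 := congrArg (smoothEval ⟨p, hp⟩) hK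
    simp [smoothEval_ofNat] at e0 e1 e2 e3 e4 e5
    refine Prod.ext ?_ ?_ <;> funext i <;> fin_cases i <;>
      simp [rmkdvScaling, rmkdvShiftZ, rmkdvShiftTau, rmkdvGauge]
    · linear_combination e0
    · linear_combination e1
    · linear_combination e2
    · linear_combination e3
    · linear_combination e4
    · linear_combination e5
  · rintro ⟨D₁, D₂, D₃, g, hg, hXg⟩
    refine rmkdvDetermining_of_eq (c := algebraMap 𝕜 _ D₁)
      (z := algebraMap 𝕜 _ D₂)
      (t := 3 * algebraMap 𝕜 _ D₁ * xCoord Ω 1 + algebraMap 𝕜 _ D₃) (g := spectralFun hg)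
      (uCoord_mul_inv hU) (fun i => xDer_xCoord ho i 2) (fun α => uDer_xCoord ho α 2)
      (fun i => xDer_uCoord ho i 0) (fun α => uDer_uCoord ho α 0)
      (fun i => xDer_uCoord ho i 1) (fun α => uDer_uCoord ho α 1)
      (fun i => xDer_uCoord ho i 2) (fun α => uDer_uCoord ho α 2)
      (fun i => Derivation.map_algebraMap _ _) (fun α => Derivation.map_algebraMap _ _)
      (fun i => Derivation.map_algebraMap _ _) (fun α => Derivation.map_algebraMap _ _)
      (fun i => by simp [xDer_xCoord, Derivation.map_ofNat_eq_zero])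
      (fun α => by simp [uDer_xCoord, Derivation.map_ofNat_eq_zero])
      (pdiff_spectralFun ho hg (by simp [xVec])) (pdiff_spectralFun ho hg (by simp [xVec]))
      (fun α => pdiff_spectralFun ho hg (by simp [uVec])) ?_ ?_ <;> funext i <;>
      refine smoothEval_ext fun p => ?_
    · rw [smoothEval_xCoeff, hXg p p.2]
      fin_cases i <;>
        simp [rmkdvScaling, rmkdvShiftZ, rmkdvShiftTau, rmkdvGauge, smoothEval_ofNat]
      ring
    · rw [smoothEval_uCoeff, hXg p p.2]
      fin_cases i <;>
        simp [rmkdvScaling, rmkdvShiftZ, rmkdvShiftTau, rmkdvGauge]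

theorem rmkdv_coefficients_unique {Ω : Set (TotalSpace 𝕜 3 3)} (hΩ : IsLaxDomain Ω 0)
    {D₁ D₂ D₃ : 𝕜} {g : 𝕜 → 𝕜}
    (h : ∀ p ∈ Ω, D₁ • rmkdvScaling p + D₂ • rmkdvShiftZ p + D₃ • rmkdvShiftTau p
      + g (p.1 2) • rmkdvGauge p = 0) :
    D₁ = 0 ∧ D₂ = 0 ∧ D₃ = 0 ∧ ∀ c ∈ spectralValues Ω, g c = 0 := by
  obtain ⟨-, h2⟩ := eq_zero_of_mul_xCoord_add hΩ.isOpen hΩ.isConnected.nonempty (i := 0)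
    (a := 0) (b := D₂) fun p hp => by
      simpa [rmkdvScaling, rmkdvShiftZ, rmkdvShiftTau, rmkdvGauge]
        using congrArg (fun v => v.1 0) (h p hp)
  obtain ⟨h1, h3⟩ := eq_zero_of_mul_xCoord_add hΩ.isOpen hΩ.isConnected.nonempty (i := 1)
    (a := 3 * D₁) (b := D₃) fun p hp => by
      have := congrArg (fun v => v.1 1) (h p hp)
      simp [rmkdvScaling, rmkdvShiftZ, rmkdvShiftTau, rmkdvGauge] at this
      linear_combination this
  refine ⟨(mul_eq_zero.1 h1).resolve_left three_ne_zero, h2, h3, ?_⟩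
  rintro _ ⟨p, hp, rfl⟩
  obtain ⟨q, hq, hqp, hne⟩ := exists_mem_uCoord_ne_zero hΩ.isOpen 1 hp
  have := congrArg (fun v => v.2 1) (h q hq)
  simp [rmkdvScaling, rmkdvShiftZ, rmkdvShiftTau, rmkdvGauge, hqp, hne] at this
  exact this

/-- The scaling field is linear in the coordinates. The two shifts are constant, so this is the only
derivative that enters the brackets. -/
lemma fderiv_rkdvScaling (p v : TotalSpace 𝕜 3 2) :
    fderiv 𝕜 rkdvScaling p v = rkdvScaling v := by
  have h : IsBoundedLinearMap 𝕜 (rkdvScaling : TotalSpace 𝕜 3 2 → TotalSpace 𝕜 3 2) := by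
    let L : TotalSpace 𝕜 3 2 →ₗ[𝕜] TotalSpace 𝕜 3 2 :=
      { toFun := rkdvScaling
        map_add' := fun x y => by
          refine Prod.ext ?_ ?_ <;> funext i <;> fin_cases i <;> simp [rkdvScaling] <;> ring
        map_smul' := fun c x => by
          refine Prod.ext ?_ ?_ <;> funext i <;> fin_cases i <;> simp [rkdvScaling] <;> ring }
    exact (LinearMap.toContinuousLinearMap L).isBoundedLinearMap
  rw [h.fderiv]
  rfl

lemma rkdv_lieBracket (p : TotalSpace 𝕜 3 2) :
    VectorField.lieBracket 𝕜 rkdvScaling rkdvShiftY p = -rkdvShiftY p ∧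
    VectorField.lieBracket 𝕜 rkdvScaling rkdvShiftT p = (3 : 𝕜) • rkdvShiftT p ∧
    VectorField.lieBracket 𝕜 rkdvShiftY rkdvShiftT p = 0 := by
  have hY : fderiv 𝕜 (rkdvShiftY : TotalSpace 𝕜 3 2 → TotalSpace 𝕜 3 2) p = 0 :=
    fderiv_const_apply _
  have hT : fderiv 𝕜 (rkdvShiftT : TotalSpace 𝕜 3 2 → TotalSpace 𝕜 3 2) p = 0 :=
    fderiv_const_apply _
  simp only [VectorField.lieBracket, hY, hT, fderiv_rkdvScaling]
  refine ⟨?_, ?_, ?_⟩ <;> refine Prod.ext ?_ ?_ <;> funext i <;> fin_cases i <;>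
    simp [rkdvScaling, rkdvShiftY, rkdvShiftT]

end Classification

end

theorem mainTheorem3 {𝕜 : Type*} [RCLike 𝕜] :
    -- the Lax pair of RKdV
    (∀ Ω : Set (TotalSpace 𝕜 3 2), IsLaxDomain Ω 0 →
      (∀ X : TotalSpace 𝕜 3 2 → TotalSpace 𝕜 3 2, ContDiffOn 𝕜 ∞ X Ω →
        (IsLiePointSymmetry rkdvLax Ω X ↔
          ∃ (C₁ C₂ C₃ : 𝕜) (f : 𝕜 → 𝕜), ContDiffOn 𝕜 ∞ f (spectralValues Ω) ∧
            ∀ p ∈ Ω, X p = C₁ • rkdvScaling p + C₂ • rkdvShiftY p + C₃ • rkdvShiftT p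
              + f (p.1 2) • rkdvGauge p)) ∧
      (∀ (C₁ C₂ C₃ : 𝕜) (f : 𝕜 → 𝕜),
        (∀ p ∈ Ω, C₁ • rkdvScaling p + C₂ • rkdvShiftY p + C₃ • rkdvShiftT p
              + f (p.1 2) • rkdvGauge p = 0) →
          C₁ = 0 ∧ C₂ = 0 ∧ C₃ = 0 ∧ ∀ c ∈ spectralValues Ω, f c = 0)) ∧
    -- the three generators without arbitrary function span a Lie algebra
    (∀ p : TotalSpace 𝕜 3 2,
      VectorField.lieBracket 𝕜 rkdvScaling rkdvShiftY p = -rkdvShiftY p ∧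
      VectorField.lieBracket 𝕜 rkdvScaling rkdvShiftT p = (3 : 𝕜) • rkdvShiftT p ∧
      VectorField.lieBracket 𝕜 rkdvShiftY rkdvShiftT p = 0) ∧
    -- the Lax pair of RmKdV
    (∀ Ω : Set (TotalSpace 𝕜 3 3), IsLaxDomain Ω 0 →
      (∀ X : TotalSpace 𝕜 3 3 → TotalSpace 𝕜 3 3, ContDiffOn 𝕜 ∞ X Ω →
        (IsLiePointSymmetry rmkdvLax Ω X ↔
          ∃ (D₁ D₂ D₃ : 𝕜) (g : 𝕜 → 𝕜), ContDiffOn 𝕜 ∞ g (spectralValues Ω) ∧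
            ∀ p ∈ Ω, X p = D₁ • rmkdvScaling p + D₂ • rmkdvShiftZ p + D₃ • rmkdvShiftTau p
              + g (p.1 2) • rmkdvGauge p)) ∧
      (∀ (D₁ D₂ D₃ : 𝕜) (g : 𝕜 → 𝕜),
        (∀ p ∈ Ω, D₁ • rmkdvScaling p + D₂ • rmkdvShiftZ p + D₃ • rmkdvShiftTau p
              + g (p.1 2) • rmkdvGauge p = 0) →
          D₁ = 0 ∧ D₂ = 0 ∧ D₃ = 0 ∧ ∀ c ∈ spectralValues Ω, g c = 0)) := by
  exact ⟨fun Ω hΩ => ⟨fun X hX => isLiePointSymmetry_rkdvLax hΩ hX,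
      fun _ _ _ _ h => rkdv_coefficients_unique hΩ h⟩,
    rkdv_lieBracket, fun Ω hΩ => ⟨fun X hX => isLiePointSymmetry_rmkdvLax hΩ hX,
      fun _ _ _ _ h => rmkdv_coefficients_unique hΩ h⟩⟩
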